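/- Let $G=(V,E)$ be a finite simple undirected graph with nodes $V=\{0,\dots,N-1\}$, let $\Delta$ be the set of its triangles, and for $T\in\Delta$ write $e\in T$ if both endpoints of the edge $e\in E$ lie in $T$. The triangle-to-edge assignment problem is $$\min\ \sum_{e\in E}\Bigl(\sum_{T\in\Delta,\ e\in T}x_{T,e}\Bigr)^2\quad\text{subject to}\quad \sum_{e\in T}x_{T,e}=1\ \ (T\in\Delta),\qquad x_{T,e}\in\{0,1\}\ \ (T\in\Delta,\ e\in T).$$ In the restricted assignment problem for unit jobs one is given finitely many jobs, machines and a set $A$ of allowed job–machine pairs; an assignment is a map $\sigma$ from jobs to machines with $(j,\sigma(j))\in A$ for every job $j$; the load of a machine is the number of jobs assigned to it; and $\sigma$ is $\ell_2$-optimal if the $\ell_2$ norm of its vector of loads is least among all assignments. Running time is the number of steps on a deterministic random access machine with finitely many registers and arrays of natural numbers, all initially $0$ apart from the input, whose unit-cost commands are: do nothing, load a constant, copy a register, add or subtract $1$, read or write an array cell at the index held in a register, sequencing, and branching (if, while) on comparisons of two registers. **Theorem (Exact algorithm for optimal assignment).** 1. There are a program and a constant $C$ such that, for every $G$ and every list of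 the triangles of $G$ (each once, in any order, given by its three nodes in any order, together with $|\Delta|$), the program halts after at most $C(|\Delta|^4+1)$ steps and outputs, for each listed triangle, the two endpoints of the edge to which it is assigned, in an optimal solution of the triangle-to-edge assignment problem. That is, the problem is solved optimally in $O(|\Delta|^4)$ time. 2. The problem reduces to $\ell_2$-optimal restricted assignment of unit jobs: let the jobs be the triangles, the machines be the edges, and the allowed pairs be the pairs $(T,e)$ with $e\in T$. There are exactly $3|\Delta|$ allowed pairs; $x$ is feasible if and only if, for some assignment $\sigma$, one has $x_{T,e}=1$ if $\sigma(T)=e$ and $x_{T,e}=0$ otherwise, for all $T\in\Delta$ and $e\in T$; for such $x$ and $\sigma$ the objective value of $x$ equals the square of the $\ell_2$ norm of the loads of $\sigma$, and $x$ is optimal if and only if $\sigma$ is $\ell_2$-optimal. 3. There are a program and a constant $C$ such that, for every instance of restricted assignment with $n$ unit jobs, finitely many machines and $m$ allowed pairs in which every job has an allowed machine, given $n$, $m$ and a list of the allowed pairs (each once, in any order), the program halts after at most $C(n^3m+1)$ steps and outputs an $\ell_2$-optimal assignment. That is, this problem is solved in $O(n^3m)$ time. -/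

import Mathlib

/-! ## Machine model

A deterministic random access machine, programmed by structured commands.  The memory consists of
registers and arrays of natural numbers; a program mentions only finitely many of them.  The only
arithmetic operations are `± 1`, so after `t` steps no stored number exceeds
`t` plus the largest number of the input and of the program text: words stay short, and charging
one time unit for each elementary command is the usual convention for word RAMs. -/

namespace RAM

/-- Memory contents: `reg r` is register `r`, and `arr a i` is cell `i` of array `a`. -/
structure Mem where
  reg : ℕ → ℕ
  arr : ℕ → ℕ → ℕ

def Mem.setReg (s : Mem) (r v : ℕ) : Mem :=
  { s with reg := Function.update s.reg r v }

def Mem.setCell (s : Mem) (a i v : ℕ) : Mem :=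
  { s with arr := Function.update s.arr a (Function.update (s.arr a) i v) }

/-- Tests: comparison of two registers. -/
inductive Test where
  | eq (r q : ℕ)
  | lt (r q : ℕ)

def Test.holds : Test → Mem → Bool
  | .eq r q, s => decide (s.reg r = s.reg q)
  | .lt r q, s => decide (s.reg r < s.reg q)

/-- Commands (programs). -/
inductive Cmd where
  /-- do nothing -/
  | skip
  /-- `r := k`, a numeral of the program text -/
  | const (r k : ℕ)
  /-- `r := q` -/
  | copy (r q : ℕ)
  /-- `r := r + 1` -/
  | inc (r : ℕ)
  /-- `r := r - 1`, where `0 - 1 = 0` -/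
  | dec (r : ℕ)
  /-- `r := a[q]`, with array `a` and the content of register `q` as index -/
  | load (r a q : ℕ)
  /-- `a[q] := r`, with array `a` and the content of register `q` as index -/
  | store (a q r : ℕ)
  /-- sequential composition -/
  | seq (c d : Cmd)
  /-- if `b` then `c` else `d` -/
  | ite (b : Test) (c d : Cmd)
  /-- while `b` do `c` -/
  | loop (b : Test) (c : Cmd)

/-- A configuration: the stack of commands still to be executed, and the memory. -/
abbrev Config := List Cmd × Mem

/-- One time step.  A configuration with an empty stack has halted. -/
def step : Config → Config
  | ([], s) => ([], s)
  | (.skip :: K, s) => (K, s)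
  | (.const r k :: K, s) => (K, s.setReg r k)
  | (.copy r q :: K, s) => (K, s.setReg r (s.reg q))
  | (.inc r :: K, s) => (K, s.setReg r (s.reg r + 1))
  | (.dec r :: K, s) => (K, s.setReg r (s.reg r - 1))
  | (.load r a q :: K, s) => (K, s.setReg r (s.arr a (s.reg q)))
  | (.store a q r :: K, s) => (K, s.setCell a (s.reg q) (s.reg r))
  | (.seq c d :: K, s) => (c :: d :: K, s)
  | (.ite b c d :: K, s) => (bif b.holds s then c :: K else d :: K, s)
  | (.loop b c :: K, s) => (bif b.holds s then c :: .loop b c :: K else K, s)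

/-- Started in memory `s`, the program `P` halts after at most `B` steps, leaving memory `s'`. -/
def HaltsWithin (P : Cmd) (s : Mem) (B : ℕ) (s' : Mem) : Prop :=
  ∃ t ≤ B, step^[t] ([P], s) = ([], s')

/-- The finite sequence `f`, padded with zeros. -/
def pad {n : ℕ} (f : Fin n → ℕ) (i : ℕ) : ℕ :=
  if h : i < n then f ⟨i, h⟩ else 0

end RAM

/-! ## Restricted assignment of unit jobs -/

namespace RestrictedAssignment

variable {J M : Type*} [Fintype J] [Fintype M] [DecidableEq M]

/-- Every job is assigned to one of its allowed machines. -/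
def IsAssignment (allowed : Finset (J × M)) (σ : J → M) : Prop :=
  ∀ j, (j, σ j) ∈ allowed

/-- The load of a machine: the number of unit jobs assigned to it. -/
def load (σ : J → M) (e : M) : ℕ :=
  (Finset.univ.filter fun j => σ j = e).card

/-- The `ℓ₂` norm of the vector of machine loads. -/
noncomputable def l2Norm (σ : J → M) : ℝ :=
  Real.sqrt (∑ e, (load σ e : ℝ) ^ 2)

/-- `σ` is an assignment whose load vector has the least `ℓ₂` norm. -/
def IsOptimal (allowed : Finset (J × M)) (σ : J → M) : Prop :=
  IsAssignment allowed σ ∧ ∀ τ, IsAssignment allowed τ → l2Norm σ ≤ l2Norm τ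

/-- The initial memory for an instance with `n` jobs, `k` machines and the list `p` of the `m`
allowed job-machine pairs: `n` and `m` are in registers `0` and `1`, the job and the machine of the
`i`-th pair are in cell `i` of arrays `0` and `1`; everything else is `0`. -/
def input {n k m : ℕ} (p : Fin m → Fin n × Fin k) : RAM.Mem where
  reg := fun r => if r = 0 then n else if r = 1 then m else 0
  arr := fun a =>
    if a = 0 then RAM.pad fun i => ((p i).1 : ℕ)
    else if a = 1 then RAM.pad fun i => ((p i).2 : ℕ)
    else fun _ => 0

end RestrictedAssignment

/-! ## Assigning triangles to edges -/

namespace TriangleAssignment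

variable {N : ℕ} (G : SimpleGraph (Fin N)) [DecidableRel G.Adj]

/-- The set `Δ` of triangles of `G`, as sets of three nodes. -/
abbrev triangles : Finset (Finset (Fin N)) := G.cliqueFinset 3

/-- The edges of `G` both of whose endpoints lie in `T`: the relation `e ∈ T`. -/
def edgesOf (T : Finset (Fin N)) : Finset (Sym2 (Fin N)) :=
  G.edgeFinset.filter fun e => ∀ v ∈ e, v ∈ T

/-- Feasibility of `x`, of which only the values `x T e` with `T ∈ Δ`, `e ∈ T` matter:
these are `0` or `1`, and every triangle is assigned to exactly one of its edges. -/
def Feasible (x : Finset (Fin N) → Sym2 (Fin N) → ℕ) : Prop :=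
  (∀ T ∈ triangles G, ∑ e ∈ edgesOf G T, x T e = 1) ∧
    ∀ T ∈ triangles G, ∀ e ∈ edgesOf G T, x T e = 0 ∨ x T e = 1

/-- The sum over all edges of the squared load. -/
def objective (x : Finset (Fin N) → Sym2 (Fin N) → ℕ) : ℕ :=
  ∑ e ∈ G.edgeFinset, (∑ T ∈ (triangles G).filter (fun T => e ∈ edgesOf G T), x T e) ^ 2

/-- `x` is an optimal solution of the triangle-to-edge assignment problem. -/
def IsOptimal (x : Finset (Fin N) → Sym2 (Fin N) → ℕ) : Prop :=
  Feasible G x ∧ ∀ y, Feasible G y → objective G x ≤ objective G y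

/-- The restricted assignment instance with the triangles as jobs and the edges as machines, where
a triangle may be processed exactly by its edges. -/
def allowed : Finset (triangles G × G.edgeFinset) :=
  Finset.univ.filter fun q => (q.2 : Sym2 (Fin N)) ∈ edgesOf G q.1

/-- `x T e` indicates whether the job `T` is assigned by `σ` to the machine `e`. -/
def Encodes (x : Finset (Fin N) → Sym2 (Fin N) → ℕ) (σ : triangles G → G.edgeFinset) : Prop :=
  ∀ T : triangles G, ∀ e ∈ edgesOf G T, x T e = if (σ T : Sym2 (Fin N)) = e then 1 else 0

/-- `tri` lists every triangle of `G` exactly once, by its three nodes in any order. -/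
def Enumerates {n : ℕ} (tri : Fin n → Fin 3 → Fin N) : Prop :=
  Set.BijOn (fun i => Finset.univ.image (tri i)) Set.univ (triangles G : Set (Finset (Fin N)))

/-- The initial memory for a list of `n` triangles: `n` is in register `0`, and for `a = 0, 1, 2`
the node number `a` of the `i`-th triangle is in cell `i` of array `a`; everything else is `0`. -/
def input {n : ℕ} (tri : Fin n → Fin 3 → Fin N) : RAM.Mem where
  reg := fun r => if r = 0 then n else 0
  arr := fun a => if h : a < 3 then RAM.pad fun i => (tri i ⟨a, h⟩ : ℕ) else fun _ => 0

/-- The memory `s` holds the solution `x`: the cells `i` of arrays `3` and `4` are the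
two endpoints of the edge to which the `i`-th triangle is assigned. -/
def Outputs {n : ℕ} (tri : Fin n → Fin 3 → Fin N) (s : RAM.Mem)
    (x : Finset (Fin N) → Sym2 (Fin N) → ℕ) : Prop :=
  ∀ i : Fin n, ∀ e ∈ edgesOf G (Finset.univ.image (tri i)),
    x (Finset.univ.image (tri i)) e =
      if Sym2.map (fun v : Fin N => (v : ℕ)) e = s(s.arr 3 i, s.arr 4 i) then 1 else 0

end TriangleAssignment

/-!
An optimal assignment is built in `n` phases, each of which assigns one more job along an
augmenting path.

*Certificate.*  Give every machine `e` a level `y e` that is its load or its load plus one, so that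
`2 * y e - 1` is a subgradient of `l ↦ l²` at the load.  If every job sits on an allowed machine of
least level, then convexity bounds the sum of squared loads of every other assignment from below
(`SemiMatching.cost_le_of_levels`).  The levels occur only in the proof, not in the program.

*Phase.*  The unassigned jobs are held by a fictitious machine `0`.  Let `R` be the set of machines
reached from it by moving jobs to machines on which they are allowed, and let `t` be a least loaded
machine in `R`, of load `l`.  Shifting jobs along a path from `0` to `t` assigns one more job and
raises only the load of `t`.  Raising all levels in `R` to at least `l + 1` gives a certificate
again: `R` is closed under the moves of its jobs, levels do not decrease along the path, and the
level of `t` was at most `l + 1`, so that all machines on the path end with level exactly `l + 1`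
(`SemiMatching.Augmenting.next`, `SemiMatching.Augmenting.finish`).

*Time.*  The search scans the list of the `m` pairs in rounds, until a round marks no machine that
carries a job.  All rounds but the last reach a new job, so there are at most `n + 1` rounds, and all
phases together take `O(n² m)` steps (`SemiMatching.within_core`).  The running times come from a
small program logic for the machine model, whose judgement is `RAM.Within`.

*Triangles.*  The edges of the triangles are listed, and each is named by the last position in which
it occurs; this takes quadratic time.  What remains is an instance with `|Δ|` jobs and `3|Δ|` pairs.
-/

/-! ### Time-bounded correctness of programs -/

namespace RAM

/-- From memory `s`, the command `c` finishes after at most `B` steps in a memory satisfying `Q`,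
whatever commands are waiting on the stack. -/
def Within (c : Cmd) (B : ℕ) (s : Mem) (Q : Mem → Prop) : Prop :=
  ∃ t s', t ≤ B ∧ (∀ K, step^[t] (c :: K, s) = (K, s')) ∧ Q s'

theorem Within.mono {c : Cmd} {B B' : ℕ} {s : Mem} {Q Q' : Mem → Prop} (h : Within c B s Q)
    (hB : B ≤ B') (hQ : ∀ s', Q s' → Q' s') : Within c B' s Q' := by
  obtain ⟨t, s', ht, hs, hq⟩ := h
  exact ⟨t, s', ht.trans hB, hs, hQ _ hq⟩

theorem Within.haltsWithin {c : Cmd} {B : ℕ} {s : Mem} {Q : Mem → Prop} (h : Within c B s Q) :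
    ∃ s', HaltsWithin c s B s' ∧ Q s' := by
  obtain ⟨t, s', ht, hs, hq⟩ := h
  exact ⟨s', ⟨t, ht, hs []⟩, hq⟩

theorem Within.seq {c d : Cmd} {B₁ B₂ : ℕ} {s : Mem} {R Q : Mem → Prop}
    (hc : Within c B₁ s R) (hd : ∀ s', R s' → Within d B₂ s' Q) :
    Within (.seq c d) (B₁ + B₂ + 1) s Q := by
  obtain ⟨t, s', ht, hs, hr⟩ := hc
  obtain ⟨t', s'', ht', hs', hq⟩ := hd s' hr
  refine ⟨t' + t + 1, s'', by omega, fun K => ?_, hq⟩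
  rw [Function.iterate_succ_apply, Function.iterate_add_apply]
  simp only [step, hs, hs']

theorem Within.ite {b : Test} {c d : Cmd} {B : ℕ} {s : Mem} {Q : Mem → Prop}
    (hc : b.holds s = true → Within c B s Q) (hd : b.holds s = false → Within d B s Q) :
    Within (.ite b c d) (B + 1) s Q := by
  rcases hb : b.holds s with _ | _
  · obtain ⟨t, s', ht, hs, hq⟩ := hd hb
    exact ⟨t + 1, s', by omega, fun K => by simp [Function.iterate_succ_apply, step, hb, hs], hq⟩
  · obtain ⟨t, s', ht, hs, hq⟩ := hc hb
    exact ⟨t + 1, s', by omega, fun K => by simp [Function.iterate_succ_apply, step, hb, hs], hq⟩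

/-- A loop with invariant `I` and variant `v`, each pass of which takes at most `B` steps. -/
theorem Within.loop {b : Test} {c : Cmd} {B : ℕ} (I : Mem → Prop) (v : Mem → ℕ)
    (hbody : ∀ s, I s → b.holds s = true → Within c B s fun s' => I s' ∧ v s' < v s)
    (V : ℕ) (s : Mem) (hI : I s) (hV : v s ≤ V) :
    Within (.loop b c) (V * (B + 2) + 1) s fun s' => I s' ∧ b.holds s' = false := by
  induction V using Nat.strong_induction_on generalizing s with
  | _ V ih =>
    rcases hb : b.holds s with _ | _
    · exact ⟨1, s, by omega, fun K => by simp [step, hb], hI, hb⟩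
    · obtain ⟨t, s', ht, hs, hI', hv⟩ := hbody s hI hb
      obtain ⟨t', s'', ht', hs', hq⟩ := ih (V - 1) (by omega) s' hI' (by omega)
      refine ⟨t' + t + 1, s'', ?_, fun K => ?_, hq⟩
      · obtain ⟨W, rfl⟩ : ∃ W, V = W + 1 := ⟨V - 1, by omega⟩
        rw [Nat.add_sub_cancel] at ht'
        rw [Nat.add_mul]
        omega
      · rw [Function.iterate_succ_apply, Function.iterate_add_apply]
        simp only [step, hb, cond_true, hs, hs']

/-- A loop in which register `r` counts from `0` up to the content `M` of register `l`. -/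
theorem Within.count {r l : ℕ} {c : Cmd} {B M : ℕ} (I : ℕ → Mem → Prop)
    (hr : ∀ k s, I k s → s.reg r = k ∧ s.reg l = M)
    (hbody : ∀ k s, k < M → I k s → Within c B s (I (k + 1)))
    {s : Mem} (hI : I 0 s) :
    Within (.loop (.lt r l) c) (M * (B + 2) + 1) s (I M) := by
  have := Within.loop (b := .lt r l) (c := c) (B := B) (fun s => ∃ k ≤ M, I k s)
    (fun s => M - s.reg r) ?_ M s ⟨0, by omega, hI⟩ (by omega)
  · refine this.mono le_rfl ?_
    rintro s' ⟨⟨k, hk, hIk⟩, hb⟩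
    obtain ⟨h1, h2⟩ := hr k s' hIk
    simp only [Test.holds, h1, h2, decide_eq_false_iff_not] at hb
    obtain rfl : k = M := by omega
    exact hIk
  · rintro s ⟨k, hk, hIk⟩ hb
    obtain ⟨h1, h2⟩ := hr k s hIk
    simp only [Test.holds, h1, h2, decide_eq_true_eq] at hb
    refine (hbody k s hb hIk).mono le_rfl fun s' hs' => ⟨⟨k + 1, by omega, hs'⟩, ?_⟩
    obtain ⟨h3, -⟩ := hr _ s' hs'
    simp only [h1, h3]
    omega

/-- The effect of a command without loops. -/
def exec : Cmd → Mem → Mem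
  | .skip, s => s
  | .const r k, s => s.setReg r k
  | .copy r q, s => s.setReg r (s.reg q)
  | .inc r, s => s.setReg r (s.reg r + 1)
  | .dec r, s => s.setReg r (s.reg r - 1)
  | .load r a q, s => s.setReg r (s.arr a (s.reg q))
  | .store a q r, s => s.setCell a (s.reg q) (s.reg r)
  | .seq c d, s => exec d (exec c s)
  | .ite b c d, s => if b.holds s = true then exec c s else exec d s
  | .loop _ _, s => s

/-- An upper bound on the running time of a command without loops; `none` if there is a loop. -/
def timeBound : Cmd → Option ℕ
  | .seq c d => do return (← timeBound c) + (← timeBound d) + 1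
  | .ite _ c d => do return max (← timeBound c) (← timeBound d) + 1
  | .loop _ _ => none
  | _ => some 1

theorem within_exec {c : Cmd} {B : ℕ} (hB : timeBound c = some B) {s : Mem} :
    Within c B s fun s' => s' = exec c s := by
  induction c generalizing B s with
  | seq c d hc hd =>
    simp only [timeBound, Option.bind_eq_bind, Option.bind_eq_some_iff, Option.pure_def,
      Option.some.injEq] at hB
    obtain ⟨B₁, h₁, B₂, h₂, rfl⟩ := hB
    refine Within.seq (hc h₁) ?_
    rintro _ rfl
    exact hd h₂
  | ite b c d hc hd =>
    simp only [timeBound, Option.bind_eq_bind, Option.bind_eq_some_iff, Option.pure_def,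
      Option.some.injEq] at hB
    obtain ⟨B₁, h₁, B₂, h₂, rfl⟩ := hB
    refine Within.ite (fun hb => ?_) fun hb => ?_
    · exact (hc h₁).mono (le_max_left _ _) fun s' h => by simp [h, exec, hb]
    · exact (hd h₂).mono (le_max_right _ _) fun s' h => by simp [h, exec, hb]
  | loop b c _ => simp [timeBound] at hB
  | _ =>
    simp only [timeBound, Option.some.injEq] at hB
    subst hB
    exact ⟨1, _, le_rfl, fun K => rfl, rfl⟩

theorem Within.of_exec {c : Cmd} {B : ℕ} {s : Mem} {Q : Mem → Prop} (hB : timeBound c = some B)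
    (h : Q (exec c s)) : Within c B s Q :=
  (within_exec hB).mono le_rfl fun _ hs => hs ▸ h

@[simp] theorem Mem.reg_setReg (s : Mem) (r v q : ℕ) :
    (s.setReg r v).reg q = if q = r then v else s.reg q := by
  simp [Mem.setReg, Function.update_apply]

@[simp] theorem Mem.arr_setReg (s : Mem) (r v : ℕ) : (s.setReg r v).arr = s.arr := rfl

@[simp] theorem Mem.reg_setCell (s : Mem) (a i v : ℕ) : (s.setCell a i v).reg = s.reg := rfl

@[simp] theorem Mem.arr_setCell (s : Mem) (a i v b : ℕ) :
    (s.setCell a i v).arr b = if b = a then Function.update (s.arr a) i v else s.arr b := by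
  simp only [Mem.setCell, Function.update_apply]

end RAM

/-! ### Optimality certificates and augmentation -/

namespace SemiMatching

open Finset

/-- The number of jobs below `n` on machine `e`. -/
def ld (n : ℕ) (σ : ℕ → ℕ) (e : ℕ) : ℕ := #{i ∈ range n | σ i = e}

/-- The sum of the squared loads, written as a sum over the jobs so that no set of machines has to
be named. -/
def cost (n : ℕ) (σ : ℕ → ℕ) : ℕ := ∑ i ∈ range n, ld n σ (σ i)

theorem sum_comp_eq (n : ℕ) (σ : ℕ → ℕ) (S : Finset ℕ) (hS : ∀ i < n, σ i ∈ S) (f : ℕ → ℤ) :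
    ∑ i ∈ range n, f (σ i) = ∑ e ∈ S, (ld n σ e : ℤ) * f e := by
  rw [← sum_fiberwise_of_maps_to (s := range n) (t := S) (g := σ) (by simpa using hS)]
  refine sum_congr rfl fun e _ => ?_
  rw [sum_congr rfl (g := fun _ => f e) (by simp +contextual)]
  simp [ld]

/-- Complementary slackness for the convex cost `∑ load²`: machine `e` gets a level `y e` such that
`2 * y e - 1` is a subgradient of `l ↦ l²` at its load, and every job sits on an allowed machine of
least level.  Then no other assignment is cheaper. -/
theorem cost_le_of_levels (n : ℕ) (σ τ y : ℕ → ℕ)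
    (hle : ∀ i < n, ld n σ (σ i) ≤ y (σ i))
    (hlo : ∀ i < n, ld n σ (τ i) ≤ y (τ i)) (hlo' : ∀ i < n, y (τ i) ≤ ld n σ (τ i) + 1)
    (hle' : ∀ i < n, y (σ i) ≤ ld n σ (σ i) + 1)
    (hy : ∀ i < n, y (σ i) ≤ y (τ i)) : cost n σ ≤ cost n τ := by
  set S := (range n).image σ ∪ (range n).image τ with hS
  have hSσ : ∀ i < n, σ i ∈ S := fun i hi =>
    mem_union_left _ (mem_image_of_mem _ (mem_range.2 hi))
  have hSτ : ∀ i < n, τ i ∈ S := fun i hi =>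
    mem_union_right _ (mem_image_of_mem _ (mem_range.2 hi))
  have h1 := sum_comp_eq n σ S hSσ fun e => (ld n σ e : ℤ)
  have h2 := sum_comp_eq n τ S hSτ fun e => (ld n τ e : ℤ)
  have h3 := sum_comp_eq n σ S hSσ fun e => 2 * (y e : ℤ) - 1
  have h4 := sum_comp_eq n τ S hSτ fun e => 2 * (y e : ℤ) - 1
  have h5 : ∑ i ∈ range n, (2 * (y (σ i) : ℤ) - 1) ≤ ∑ i ∈ range n, (2 * (y (τ i) : ℤ) - 1) := by
    refine sum_le_sum fun i hi => ?_
    have := hy i (mem_range.1 hi)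
    omega
  have h6 : ∀ e ∈ S, (ld n τ e : ℤ) * (2 * y e - 1) - ld n σ e * (2 * y e - 1)
      ≤ ld n τ e * ld n τ e - ld n σ e * ld n σ e := by
    intro e he
    have hb : ld n σ e ≤ y e ∧ y e ≤ ld n σ e + 1 := by
      rcases mem_union.1 he with he | he <;> obtain ⟨i, hi, rfl⟩ := mem_image.1 he <;>
        rw [mem_range] at hi
      exacts [⟨hle i hi, hle' i hi⟩, ⟨hlo i hi, hlo' i hi⟩]
    -- the difference of the two sides is `(τ - σ) * (τ + σ - (2 * y - 1))` in the two loads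
    have key : 0 ≤ ((ld n τ e : ℤ) - ld n σ e) * (ld n τ e + ld n σ e - (2 * y e - 1)) := by
      rcases lt_trichotomy (ld n τ e) (ld n σ e) with h | h | h
      · exact mul_nonneg_of_nonpos_of_nonpos (by omega) (by omega)
      · simp [h]
      · exact mul_nonneg (by omega) (by omega)
    linarith
  have h7 := sum_le_sum h6
  rw [sum_sub_distrib, sum_sub_distrib] at h7
  have h8 : (cost n σ : ℤ) ≤ cost n τ := by
    simp only [cost, Nat.cast_sum]
    linarith
  exact_mod_cast h8

theorem ld_update {n : ℕ} {σ : ℕ → ℕ} {i : ℕ} (hi : i < n) (e x : ℕ) :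
    ld n (Function.update σ i e) x + (if x = σ i then 1 else 0)
      = ld n σ x + if x = e then 1 else 0 := by
  have h : ∀ τ : ℕ → ℕ, ld n τ x
      = #{k ∈ (range n).erase i | τ k = x} + if x = τ i then 1 else 0 := by
    intro τ
    rw [ld, ← insert_erase (mem_range.2 hi), filter_insert, erase_insert_eq_erase, erase_idem]
    by_cases hx : τ i = x
    · rw [if_pos hx, if_pos hx.symm, card_insert_of_notMem (by simp)]
    · rw [if_neg hx, if_neg (Ne.symm hx), add_zero]
  have h' : #{k ∈ (range n).erase i | Function.update σ i e k = x}
      = #{k ∈ (range n).erase i | σ k = x} := by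
    congr 1
    refine filter_congr fun k hk => ?_
    rw [Function.update_of_ne (ne_of_mem_erase hk)]
  rw [h, h σ, h', Function.update_self]
  omega

theorem ld_pos {n : ℕ} {σ : ℕ → ℕ} {i : ℕ} (hi : i < n) : 0 < ld n σ (σ i) :=
  card_pos.2 ⟨i, by simp [hi]⟩

theorem exists_of_ld_pos {n : ℕ} {σ : ℕ → ℕ} {e : ℕ} (h : 0 < ld n σ e) : ∃ i < n, σ i = e := by
  obtain ⟨i, hi⟩ := card_pos.1 h
  exact ⟨i, by simpa using hi⟩

theorem ld_add_ld_le {n : ℕ} {σ : ℕ → ℕ} {e e' : ℕ} (h : e ≠ e') : ld n σ e + ld n σ e' ≤ n := by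
  rw [ld, ld, ← card_union_of_disjoint]
  · exact (card_le_card (union_subset (filter_subset _ _) (filter_subset _ _))).trans
      (card_range n).le
  · rw [disjoint_filter]
    rintro i - rfl
    exact h

/-- A list of `m` allowed job-machine pairs `(J q, X q)` for the jobs below `n`.  Machines are
positive: the number `0` is kept for the fictitious machine that holds the unassigned jobs. -/
structure Instance (n m : ℕ) (J X : ℕ → ℕ) : Prop where
  lt : ∀ q < m, J q < n
  pos : ∀ q < m, X q ≠ 0
  ex : ∀ i < n, ∃ q < m, J q = i

/-- A partial assignment with an optimality certificate. -/
structure Good (n m : ℕ) (J X σ y : ℕ → ℕ) : Prop where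
  valid : ∀ i < n, σ i ≠ 0 → ∃ q < m, J q = i ∧ X q = σ i
  zero : y 0 = 0
  mono : ∀ q < m, y (σ (J q)) ≤ y (X q)
  lo : ∀ e ≠ 0, ld n σ e ≤ y e
  hi : ∀ e ≠ 0, y e ≤ ld n σ e + 1

/-- The machines `x` with `base ≤ mk x` form a search forest: `par x` is a job that may run on `x`
and at present runs on a machine marked before `x`.  The root is the fictitious machine `0`. -/
structure Forest (m : ℕ) (J X σ mk par : ℕ → ℕ) (base top : ℕ) : Prop where
  root : mk 0 = base
  pair : ∀ x ≠ 0, base ≤ mk x → mk x ≤ top → ∃ q < m, J q = par x ∧ X q = x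
  le : ∀ x ≠ 0, base ≤ mk x → mk x ≤ top → base ≤ mk (σ (par x))
  lt : ∀ x ≠ 0, base ≤ mk x → mk x ≤ top → mk (σ (par x)) < mk x

/-- The marked machines contain every machine on which a job of a marked machine may run. -/
def Closed (m : ℕ) (J X σ mk : ℕ → ℕ) (base : ℕ) : Prop :=
  ∀ q < m, base ≤ mk (σ (J q)) → base ≤ mk (X q)

/-- The levels after augmentation: marked machines are raised to at least `L`. -/
def raise (y mk : ℕ → ℕ) (base L e : ℕ) : ℕ :=
  if e ≠ 0 ∧ base ≤ mk e then max (y e) L else y e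

/-- The state while jobs are being shifted along a path of the forest that ends in machine `t`:
machine `e` is owed one job. -/
structure Augmenting (n m : ℕ) (J X σ₀ y mk par : ℕ → ℕ) (base L t : ℕ) (σ : ℕ → ℕ) (e : ℕ) :
    Prop where
  valid : ∀ i < n, σ i ≠ 0 → ∃ q < m, J q = i ∧ X q = σ i
  load : ∀ x, ld n σ x + (if x = e then 1 else 0) = ld n σ₀ x + if x = t then 1 else 0
  mono : ∀ q < m, raise y mk base L (σ (J q)) ≤ raise y mk base L (X q)
  closed : Closed m J X σ mk base
  marked : base ≤ mk e
  level : e ≠ 0 → raise y mk base L e = L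
  forest : Forest m J X σ mk par base (mk e)

variable {n m : ℕ} {J X σ₀ y mk par : ℕ → ℕ} {base L t : ℕ} {σ : ℕ → ℕ} {e : ℕ}

theorem Augmenting.start (hg : Good n m J X σ₀ y) (hI : Instance n m J X)
    (hc : Closed m J X σ₀ mk base) {top : ℕ} (hf : Forest m J X σ₀ mk par base top)
    (ht : base ≤ mk t) (htop : mk t ≤ top) (ht0 : t ≠ 0) (hL : L = ld n σ₀ t + 1) :
    Augmenting n m J X σ₀ y mk par base L t σ₀ t where
  valid := hg.valid
  load _ := rfl
  mono q hq := by
    have h1 := hg.mono q hq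
    have h2 := hc q hq
    have h3 := hI.pos q hq
    unfold raise
    split_ifs <;> simp_all
    omega
  closed := hc
  marked := ht
  level _ := by
    have := hg.hi t ht0
    rw [raise, if_pos ⟨ht0, ht⟩]
    omega
  forest :=
    ⟨hf.root, fun x h0 h1 h2 => hf.pair x h0 h1 (h2.trans htop),
      fun x h0 h1 h2 => hf.le x h0 h1 (h2.trans htop),
      fun x h0 h1 h2 => hf.lt x h0 h1 (h2.trans htop)⟩

theorem le_raise (h0 : e ≠ 0) (h : base ≤ mk e) : L ≤ raise y mk base L e := by
  rw [raise, if_pos ⟨h0, h⟩]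
  exact le_max_right _ _

/-- Machine `e` takes the job `par e`; now the machine that held it is owed a job. -/
theorem Augmenting.next (hI : Instance n m J X)
    (h : Augmenting n m J X σ₀ y mk par base L t σ e) (he : e ≠ 0) :
    Augmenting n m J X σ₀ y mk par base L t (Function.update σ (par e) e) (σ (par e)) ∧
      mk (σ (par e)) < mk e := by
  obtain ⟨q₀, hq₀, hJ, hX⟩ := h.forest.pair e he h.marked le_rfl
  have hm := h.forest.le e he h.marked le_rfl
  have hlt := h.forest.lt e he h.marked le_rfl
  have hn : par e < n := hJ ▸ hI.lt q₀ hq₀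
  refine ⟨⟨?_, ?_, ?_, ?_, hm, ?_, ?_⟩, hlt⟩
  · intro i hi h0
    by_cases hie : i = par e
    · subst hie
      exact ⟨q₀, hq₀, hJ, by simpa using hX⟩
    · rw [Function.update_of_ne hie] at h0 ⊢
      exact h.valid i hi h0
  · intro x
    rw [← h.load x, ld_update hn]
  · intro q hq
    by_cases hie : J q = par e
    · rw [hie, Function.update_self, h.level he]
      exact le_raise (hI.pos q hq) (h.closed q hq (by rwa [hie]))
    · rw [Function.update_of_ne hie]
      exact h.mono q hq
  · intro q hq hb
    by_cases hie : J q = par e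
    · exact h.closed q hq (by rwa [hie])
    · rw [Function.update_of_ne hie] at hb
      exact h.closed q hq hb
  · intro h0
    refine le_antisymm ?_ (le_raise h0 hm)
    have := h.mono q₀ hq₀
    rwa [hJ, hX, h.level he] at this
  · -- no machine marked up to `σ (par e)` has `par e` as its parent job
    have hne : ∀ x ≠ 0, base ≤ mk x → mk x ≤ mk (σ (par e)) → par x ≠ par e := by
      intro x h0 h1 h2 hx
      have := h.forest.lt x h0 h1 (by omega)
      rw [hx] at this
      omega
    refine ⟨h.forest.root, fun x h0 h1 h2 => h.forest.pair x h0 h1 (by omega), ?_, ?_⟩ <;>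
      intro x h0 h1 h2 <;> rw [Function.update_of_ne (hne x h0 h1 h2)]
    exacts [h.forest.le x h0 h1 (by omega), h.forest.lt x h0 h1 (by omega)]

/-- When the path is exhausted, one more job is assigned and the raised levels certify
optimality: all marked machines had at least the load of `t`. -/
theorem Augmenting.finish (hg : Good n m J X σ₀ y) (ht : base ≤ mk t) (hL : L = ld n σ₀ t + 1)
    (hmin : ∀ x ≠ 0, base ≤ mk x → ld n σ₀ t ≤ ld n σ₀ x)
    (h : Augmenting n m J X σ₀ y mk par base L t σ 0) :
    Good n m J X σ (raise y mk base L) where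
  valid := h.valid
  zero := by simp [raise, hg.zero]
  mono := h.mono
  lo x hx := by
    have h1 := h.load x
    have h2 := hg.lo x hx
    rw [if_neg hx] at h1
    by_cases hxt : x = t
    · subst hxt
      rw [if_pos rfl] at h1
      rw [raise, if_pos ⟨hx, ht⟩]
      omega
    · rw [if_neg hxt] at h1
      unfold raise
      split_ifs <;> omega
  hi x hx := by
    have h1 := h.load x
    have h2 := hg.hi x hx
    rw [if_neg hx] at h1
    unfold raise
    split_ifs with h4
    · have := hmin x hx h4.2
      split_ifs at h1 <;> omega
    · split_ifs at h1 <;> omega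

/-- A complete assignment with a certificate is optimal. -/
theorem Good.cost_le (hg : Good n m J X σ y) (hI : Instance n m J X) (h0 : ld n σ 0 = 0)
    {τ : ℕ → ℕ} (hτ : ∀ i < n, ∃ q < m, J q = i ∧ X q = τ i) : cost n σ ≤ cost n τ := by
  have hσ0 : ∀ i < n, σ i ≠ 0 := fun i hi h => by
    have := ld_pos (σ := σ) hi
    rw [h] at this
    omega
  have hτ0 : ∀ i < n, τ i ≠ 0 := fun i hi => by
    obtain ⟨q, hq, -, h⟩ := hτ i hi
    exact h ▸ hI.pos q hq
  refine cost_le_of_levels n σ τ y (fun i hi => hg.lo _ (hσ0 i hi))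
    (fun i hi => hg.lo _ (hτ0 i hi)) (fun i hi => hg.hi _ (hτ0 i hi))
    (fun i hi => hg.hi _ (hσ0 i hi)) fun i hi => ?_
  obtain ⟨q, hq, rfl, h⟩ := hτ i hi
  exact h ▸ hg.mono q hq

/-- The state of the search: all marks are at most `cnt`, and since the start of the search the
counter has advanced at most once for each listed pair with a marked machine. -/
structure Search (m : ℕ) (J X σ : ℕ → ℕ) (base : ℕ) (mk par : ℕ → ℕ) (cnt : ℕ) : Prop where
  forest : Forest m J X σ mk par base cnt
  le : ∀ x, mk x ≤ cnt
  count : cnt ≤ base + #{q ∈ range m | base ≤ mk (X q)}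

theorem Search.start {cnt : ℕ} (h : ∀ x, mk x ≤ cnt) :
    Search m J X σ (cnt + 1) (Function.update mk 0 (cnt + 1)) par (cnt + 1) := by
  have h0 : ∀ x ≠ 0, ¬ cnt + 1 ≤ Function.update mk 0 (cnt + 1) x := fun x hx => by
    rw [Function.update_of_ne hx]
    have := h x
    omega
  refine ⟨⟨by simp, ?_, ?_, ?_⟩, fun x => ?_, by omega⟩
  iterate 3 exact fun x hx hb _ => absurd hb (h0 x hx)
  by_cases hx : x = 0
  · simp [hx]
  · rw [Function.update_of_ne hx]
    have := h x
    omega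

theorem Search.mark {cnt q : ℕ} (h : Search m J X σ base mk par cnt) (hq : q < m)
    (h1 : base ≤ mk (σ (J q))) (h2 : mk (X q) < base) :
    Search m J X σ base (Function.update mk (X q) (cnt + 1)) (Function.update par (X q) (J q))
      (cnt + 1) := by
  have hb : base ≤ cnt := h1.trans (h.le _)
  have hne : ∀ z, base ≤ mk z → z ≠ X q := by
    rintro z hz rfl
    omega
  have hup : ∀ z, base ≤ mk z → Function.update mk (X q) (cnt + 1) z = mk z := fun z hz =>
    Function.update_of_ne (hne z hz) _ _
  have hold : ∀ z ≠ X q, base ≤ Function.update mk (X q) (cnt + 1) z → base ≤ mk z :=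
    fun z hz hz' => by rwa [Function.update_of_ne hz] at hz'
  refine ⟨⟨?_, ?_, ?_, ?_⟩, ?_, ?_⟩
  · rw [hup 0 h.forest.root.ge, h.forest.root]
  · intro z h0 hz _
    by_cases hzx : z = X q
    · subst hzx
      exact ⟨q, hq, by simp, rfl⟩
    · rw [Function.update_of_ne hzx]
      exact h.forest.pair z h0 (hold z hzx hz) (h.le z)
  · intro z h0 hz _
    by_cases hzx : z = X q
    · subst hzx
      rwa [Function.update_self, hup _ h1]
    · have := h.forest.le z h0 (hold z hzx hz) (h.le z)
      rwa [Function.update_of_ne hzx, hup _ this]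
  · intro z h0 hz _
    by_cases hzx : z = X q
    · subst hzx
      rw [Function.update_self, Function.update_self, hup _ h1]
      exact Nat.lt_succ_of_le (h.le _)
    · have := h.forest.le z h0 (hold z hzx hz) (h.le z)
      rw [Function.update_of_ne hzx, hup _ this, Function.update_of_ne hzx]
      exact h.forest.lt z h0 (hold z hzx hz) (h.le z)
  · intro z
    by_cases hzx : z = X q
    · simp [hzx]
    · rw [Function.update_of_ne hzx]
      exact (h.le z).trans (Nat.le_succ _)
  · have : #{q ∈ range m | base ≤ mk (X q)}
        < #{r ∈ range m | base ≤ Function.update mk (X q) (cnt + 1) (X r)} := by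
      refine card_lt_card (ssubset_iff_of_subset ?_ |>.2 ⟨q, ?_, ?_⟩)
      · intro r hr
        rw [mem_filter] at hr ⊢
        exact ⟨hr.1, by rw [hup _ hr.2]; exact hr.2⟩
      · simp only [mem_filter, mem_range, hq, Function.update_self, true_and]
        omega
      · simp only [mem_filter, not_and, not_le]
        exact fun _ => h2
    have := h.count
    omega

theorem Search.sub_le {cnt : ℕ} (h : Search m J X σ base mk par cnt) : cnt ≤ base + m :=
  h.count.trans (Nat.add_le_add_left ((card_filter_le _ _).trans (card_range m).le) _)

/-- The number of jobs that are not on marked machines. -/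
def unreached (n : ℕ) (σ mk : ℕ → ℕ) (base : ℕ) : ℕ := #{i ∈ range n | mk (σ i) < base}

theorem unreached_le : unreached n σ mk base ≤ n := (card_filter_le _ _).trans (card_range n).le

theorem unreached_update_le {x v : ℕ} (hv : base ≤ v) :
    unreached n σ (Function.update mk x v) base ≤ unreached n σ mk base := by
  refine card_le_card fun i hi => ?_
  simp only [mem_filter, Function.update_apply] at hi ⊢
  split_ifs at hi
  · omega
  · exact hi

theorem unreached_update_lt {x v : ℕ} (hv : base ≤ v) (hx : mk x < base) (h : 0 < ld n σ x) :
    unreached n σ (Function.update mk x v) base < unreached n σ mk base := by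
  obtain ⟨i, hi, rfl⟩ := exists_of_ld_pos h
  refine card_lt_card (ssubset_iff_of_subset ?_ |>.2 ⟨i, by simp [hi, hx], by simp [hv]⟩)
  intro k hk
  simp only [mem_filter, Function.update_apply] at hk ⊢
  split_ifs at hk
  · omega
  · exact hk

end SemiMatching

/-! ### The augmentation program

Register `0` holds the number of jobs, `1` the number of pairs, `2` zero, `3` the number of phases
done, `4` the mark counter, `5` the least mark of the present phase, `6` whether a round has reached
new jobs, `7` the index of a pair, `14` a machine and `15` its load; the others are scratch.  Arrays
`10` and `11` hold the jobs and the machines of the pairs, `12` the assignment, `13` the loads, `14`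
the marks and `15` the parent jobs. -/

namespace SemiMatching

open RAM Finset

/-- Look at pair `reg 7`: if its job is on a marked machine and its machine is not marked, mark the
machine, and report in register `6` if the machine is not empty. -/
def markBody : Cmd :=
  .seq (.load 8 10 7) <| .seq (.load 9 11 7) <| .seq (.load 10 12 8) <| .seq (.load 11 14 10) <|
  .seq (.load 12 14 9) <|
  .seq (.ite (.lt 11 5) .skip <| .ite (.lt 12 5)
    (.seq (.inc 4) <| .seq (.store 14 9 4) <| .seq (.store 15 9 8) <| .seq (.load 13 13 9) <|
      .ite (.lt 2 13) (.const 6 1) .skip)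
    .skip) <|
  .inc 7

/-- One round of the search, over all pairs. -/
def markRound : Cmd := .seq (.seq (.const 6 0) (.const 7 0)) (.loop (.lt 7 1) markBody)

/-- Rounds are repeated as long as they mark a nonempty machine. -/
def search : Cmd := .seq (.const 6 1) (.loop (.lt 2 6) markRound)

/-- Compare the machine of pair `reg 7`, if it is marked, with the best one so far. -/
def selectBody : Cmd :=
  .seq (.load 9 11 7) <| .seq (.load 12 14 9) <|
  .seq (.ite (.lt 12 5) .skip <| .seq (.load 13 13 9) <|
    .ite (.lt 13 15) (.seq (.copy 15 13) (.copy 14 9)) .skip) <|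
  .inc 7

/-- Put a least loaded marked machine into register `14`. -/
def select : Cmd :=
  .seq (.seq (.const 14 0) <| .seq (.copy 15 0) (.const 7 0)) (.loop (.lt 7 1) selectBody)

/-- Move the parent job of machine `reg 14` to it, and go on to the machine the job came from. -/
def augmentBody : Cmd :=
  .seq (.load 8 15 14) <| .seq (.load 10 12 8) <| .seq (.store 12 8 14) (.copy 14 10)

/-- Shift jobs along the path of the search forest that ends in machine `reg 14`. -/
def augment : Cmd :=
  .seq (.seq (.load 13 13 14) <| .seq (.inc 13) (.store 13 14 13)) (.loop (.lt 2 14) augmentBody)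

/-- Assign one more job.  A fresh mark is given to the fictitious machine `0`, and this mark
becomes the least one of the phase, so that marks never have to be cleared. -/
def phase : Cmd :=
  .seq (.seq (.inc 4) <| .seq (.copy 5 4) (.store 14 2 5)) <|
  .seq search <| .seq select <| .seq augment (.inc 3)

/-- As many phases as there are jobs. -/
def core : Cmd := .seq (.seq (.const 2 0) (.const 3 0)) (.loop (.lt 3 0) phase)

/-- What the program never changes: the sizes in registers `0` and `1`, the zero in register `2`,
and all arrays except `12` to `15`. -/
structure Frame (n m : ℕ) (A : ℕ → ℕ → ℕ) (s : Mem) : Prop where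
  jobs : s.reg 0 = n
  pairs : s.reg 1 = m
  zero : s.reg 2 = 0
  frame : ∀ a, a < 12 ∨ 15 < a → s.arr a = A a

variable {n m : ℕ} {A : ℕ → ℕ → ℕ}

/-- The state of the search in phase `u + 1`, for the assignment `σ` with loads `l`. -/
structure Searching (n m : ℕ) (A : ℕ → ℕ → ℕ) (σ l : ℕ → ℕ) (u base : ℕ) (s : Mem) : Prop
    extends Frame n m A s where
  done : s.reg 3 = u
  base_eq : s.reg 5 = base
  asg : s.arr 12 = σ
  loads : s.arr 13 = l
  search : Search m (A 10) (A 11) σ base (s.arr 14) (s.arr 15) (s.reg 4)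

/-- The state in the middle of a round: `k` pairs have been looked at, and `D` jobs were unreached
when the round began. -/
structure Round (n m : ℕ) (A : ℕ → ℕ → ℕ) (σ l : ℕ → ℕ) (u base D k : ℕ) (s : Mem) : Prop
    extends Searching n m A σ l u base s where
  idx : s.reg 7 = k
  le : unreached n σ (s.arr 14) base ≤ D
  lt : s.reg 6 ≠ 0 → unreached n σ (s.arr 14) base < D
  closed : s.reg 6 = 0 → Closed k (A 10) (A 11) σ (s.arr 14) base

variable {σ l : ℕ → ℕ} {u base D k : ℕ} {s : Mem}

theorem within_markBody (hl : ∀ e ≠ 0, l e = ld n σ e) (hI : Instance n m (A 10) (A 11))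
    (hk : k < m) (h : Round n m A σ l u base D k s) :
    Within markBody 30 s (Round n m A σ l u base D (k + 1)) := by
  refine (Within.of_exec (B := _) rfl ?_).mono (by decide) fun _ h => h
  obtain ⟨⟨⟨h0, h1, h2, hf⟩, hu, hb, ha, hld, hS⟩, h7, hle, hlt, hcl⟩ := h
  have hJ := hf 10 (by omega)
  have hX := hf 11 (by omega)
  have hk1 : ∀ {Q : ℕ → Prop}, (∀ q < k, Q q) → Q k → ∀ q < k + 1, Q q := fun hq hk q h =>
    (Nat.lt_succ_iff_lt_or_eq.1 h).elim (hq q) fun h => h ▸ hk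
  by_cases c1 : s.arr 14 (σ (A 10 k)) < base
  · refine ⟨⟨⟨?_, ?_, ?_, ?_⟩, ?_, ?_, ?_, ?_, ?_⟩, ?_, ?_, ?_, ?_⟩ <;>
      simp [markBody, exec, Test.holds, h7, hb, ha, hJ, hX, c1] <;> try assumption
    exact fun h6 => hk1 (hcl h6) fun h => by omega
  by_cases c2 : s.arr 14 (A 11 k) < base
  · have hS' := hS.mark hk (not_lt.1 c1) c2
    have hx0 := hI.pos k hk
    have hbc : base ≤ s.reg 4 + 1 := (not_lt.1 c1).trans ((hS.le _).trans (Nat.le_succ _))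
    by_cases c3 : 0 < l (A 11 k)
    · have := unreached_update_lt hbc c2 (hl _ hx0 ▸ c3)
      refine ⟨⟨⟨?_, ?_, ?_, ?_⟩, ?_, ?_, ?_, ?_, ?_⟩, ?_, ?_, ?_, ?_⟩ <;>
        simp [markBody, exec, Test.holds, h7, hb, ha, hJ, hX, c1, c2, h2, hld, c3] <;>
        try first | assumption | omega
      intro a ha
      simpa [show a ≠ 14 by omega, show a ≠ 15 by omega] using hf a ha
    · have := unreached_update_le (n := n) (σ := σ) (mk := s.arr 14) (x := A 11 k) hbc
      refine ⟨⟨⟨?_, ?_, ?_, ?_⟩, ?_, ?_, ?_, ?_, ?_⟩, ?_, ?_, ?_, ?_⟩ <;>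
        simp [markBody, exec, Test.holds, h7, hb, ha, hJ, hX, c1, c2, h2, hld, c3] <;>
        try first | assumption | omega
      · intro a ha
        simpa [show a ≠ 14 by omega, show a ≠ 15 by omega] using hf a ha
      · -- the new machine is empty, so that marking it reaches no job
        have hne : ∀ q < m, σ (A 10 q) ≠ A 11 k := fun q hq he => by
          have := ld_pos (σ := σ) (hI.lt q hq)
          rw [he, ← hl _ hx0] at this
          exact c3 this
        refine fun h6 q hq hm => ?_
        rw [Function.update_of_ne (hne q (by omega))] at hm
        rw [Function.update_apply]
        split_ifs with hx
        · exact hbc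
        · exact hcl h6 q ((Nat.lt_succ_iff_lt_or_eq.1 hq).resolve_right
            fun h => hx (h ▸ rfl)) hm
  · refine ⟨⟨⟨?_, ?_, ?_, ?_⟩, ?_, ?_, ?_, ?_, ?_⟩, ?_, ?_, ?_, ?_⟩ <;>
      simp [markBody, exec, Test.holds, h7, hb, ha, hJ, hX, c1, c2] <;> try assumption
    exact fun h6 => hk1 (hcl h6) fun _ => by omega

theorem within_search (hl : ∀ e ≠ 0, l e = ld n σ e) (hI : Instance n m (A 10) (A 11))
    (h : Searching n m A σ l u base s) :
    Within search ((n + 1) * (m * 32 + 8) + 3) s fun s => Searching n m A σ l u base s ∧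
      Closed m (A 10) (A 11) σ (s.arr 14) base := by
  -- every round but the last reaches a new job
  let v : Mem → ℕ := fun s => if s.reg 6 = 0 then 0 else unreached n σ (s.arr 14) base + 1
  refine (Within.seq (B₁ := 1) (R := fun s => Searching n m A σ l u base s ∧
    (s.reg 6 = 0 → Closed m (A 10) (A 11) σ (s.arr 14) base)) (Within.of_exec rfl ?_)
    fun s h => (Within.loop (B := m * 32 + 5) (fun s => Searching n m A σ l u base s ∧
    (s.reg 6 = 0 → Closed m (A 10) (A 11) σ (s.arr 14) base)) v ?_ (n + 1) s h ?_).mono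
      le_rfl ?_).mono ?_ fun s h => h
  · obtain ⟨⟨h0, h1, h2, hf⟩, hu, hb, ha, hld, hS⟩ := h
    refine ⟨⟨⟨?_, ?_, ?_, ?_⟩, ?_, ?_, ?_, ?_, ?_⟩, ?_⟩ <;> simp [exec] <;> assumption
  · rintro s ⟨h, -⟩ hc
    have h6 : s.reg 6 ≠ 0 := by
      simp only [Test.holds, h.zero, decide_eq_true_eq] at hc
      omega
    refine (Within.seq (R := Round n m A σ l u base (unreached n σ (s.arr 14) base) 0)
      (Within.of_exec (B := 3) rfl ?_) fun s' h' => (Within.count (B := 30) (M := m)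
        (Round n m A σ l u base (unreached n σ (s.arr 14) base))
        (fun k s h => ⟨h.idx, h.pairs⟩) (fun k s hk h => within_markBody hl hI hk h) h').mono
        le_rfl ?_).mono (by omega) fun s h => h
    · obtain ⟨⟨h0, h1, h2, hf⟩, hu, hb, ha, hld, hS⟩ := h
      refine ⟨⟨⟨?_, ?_, ?_, ?_⟩, ?_, ?_, ?_, ?_, ?_⟩, ?_, ?_, ?_, ?_⟩ <;> simp [exec] <;>
        try assumption
      simp [Closed]
    · intro s'' h''
      refine ⟨⟨h''.toSearching, h''.closed⟩, ?_⟩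
      simp only [v, h6, if_false]
      split_ifs with hz
      · omega
      · have := h''.lt hz
        omega
  · have := unreached_le (n := n) (σ := σ) (mk := s.arr 14) (base := base)
    simp only [v]
    split_ifs <;> omega
  · rintro s' ⟨⟨h, hcl⟩, hc⟩
    refine ⟨h, hcl ?_⟩
    simp only [Test.holds, h.zero, decide_eq_false_iff_not] at hc
    omega
  · have : (n + 1) * (m * 32 + 5 + 2) ≤ (n + 1) * (m * 32 + 8) := Nat.mul_le_mul_left _ (by omega)
    omega

/-- The state while a least loaded marked machine is looked for. -/
structure Selecting (n m : ℕ) (A : ℕ → ℕ → ℕ) (σ l : ℕ → ℕ) (u base : ℕ) (k : ℕ) (s : Mem) : Prop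
    extends Searching n m A σ l u base s where
  closed : Closed m (A 10) (A 11) σ (s.arr 14) base
  idx : s.reg 7 = k
  best : s.reg 15 = n ∨ s.reg 14 ≠ 0 ∧ base ≤ s.arr 14 (s.reg 14) ∧ l (s.reg 14) = s.reg 15
  least : ∀ q < k, base ≤ s.arr 14 (A 11 q) → s.reg 15 ≤ l (A 11 q)

theorem within_select (hI : Instance n m (A 10) (A 11))
    (h : Searching n m A σ l u base s) (hc : Closed m (A 10) (A 11) σ (s.arr 14) base) :
    Within select (m * 20 + 10) s (Selecting n m A σ l u base m) := by
  refine (Within.seq (B₁ := 5) (R := Selecting n m A σ l u base 0) (Within.of_exec rfl ?_)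
    fun s h => Within.count (B := 16) (Selecting n m A σ l u base)
      (fun k s h => ⟨h.idx, h.pairs⟩) ?_ h).mono (by omega) fun s h => h
  · obtain ⟨⟨h0, h1, h2, hf⟩, hu, hb, ha, hld, hS⟩ := h
    refine ⟨⟨⟨?_, ?_, ?_, ?_⟩, ?_, ?_, ?_, ?_, ?_⟩, ?_, ?_, ?_, ?_⟩ <;> simp [exec] <;>
      assumption
  · intro k s hk ⟨⟨⟨h0, h1, h2, hf⟩, hu, hb, ha, hld, hS⟩, hcl, h7, hbest, hleast⟩
    refine (Within.of_exec (B := _) rfl ?_).mono (by decide) fun _ h => h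
    have hX := hf 11 (by omega)
    have hk1 : ∀ {Q : ℕ → Prop}, (∀ q < k, Q q) → Q k → ∀ q ≤ k, Q q := fun hq hk q h =>
      (Nat.lt_or_eq_of_le h).elim (hq q) fun h => h ▸ hk
    by_cases c1 : s.arr 14 (A 11 k) < base
    · refine ⟨⟨⟨?_, ?_, ?_, ?_⟩, ?_, ?_, ?_, ?_, ?_⟩, ?_, ?_, ?_, ?_⟩ <;>
        simp [selectBody, exec, Test.holds, h7, hb, hX, c1] <;> try assumption
      exact hk1 hleast fun h => by omega
    by_cases c2 : l (A 11 k) < s.reg 15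
    · refine ⟨⟨⟨?_, ?_, ?_, ?_⟩, ?_, ?_, ?_, ?_, ?_⟩, ?_, ?_, ?_, ?_⟩ <;>
        simp [selectBody, exec, Test.holds, h7, hb, hX, c1, hld, c2] <;> try assumption
      · exact .inr ⟨hI.pos k hk, not_lt.1 c1⟩
      · exact hk1 (fun q hq h => c2.le.trans (hleast q hq h)) fun _ => le_rfl
    · refine ⟨⟨⟨?_, ?_, ?_, ?_⟩, ?_, ?_, ?_, ?_, ?_⟩, ?_, ?_, ?_, ?_⟩ <;>
        simp [selectBody, exec, Test.holds, h7, hb, hX, c1, hld, c2] <;> try assumption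
      exact hk1 hleast fun _ => not_lt.1 c2

/-- As long as some job is unassigned, a marked machine has been selected: the register for the best
load starts at `n`, and no machine carries all jobs. -/
theorem Selecting.spec (hl : ∀ e ≠ 0, l e = ld n σ e) (hI : Instance n m (A 10) (A 11))
    (h : Selecting n m A σ l u base m s) (h0 : 0 < ld n σ 0) :
    s.reg 14 ≠ 0 ∧ base ≤ s.arr 14 (s.reg 14) ∧
      ∀ x ≠ 0, base ≤ s.arr 14 x → ld n σ (s.reg 14) ≤ ld n σ x := by
  have hne : s.reg 15 ≠ n := by
    obtain ⟨i, hi, h0i⟩ := exists_of_ld_pos h0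
    obtain ⟨q, hq, rfl⟩ := hI.ex i hi
    have h1 := h.least q hq (h.closed q hq (by rw [h0i, h.search.forest.root]))
    have h2 := ld_add_ld_le (n := n) (σ := σ) (hI.pos q hq)
    rw [hl _ (hI.pos q hq)] at h1
    omega
  obtain ⟨h1, h2, h3⟩ := h.best.resolve_left hne
  refine ⟨h1, h2, fun x hx hb => ?_⟩
  obtain ⟨q, hq, -, rfl⟩ := h.search.forest.pair x hx hb (h.search.le x)
  have := h.least q hq hb
  rwa [← h3, hl _ h1, hl _ hx] at this

/-- The invariant of the main loop after `u` phases. -/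
structure Phase (n m : ℕ) (A : ℕ → ℕ → ℕ) (u : ℕ) (s : Mem) : Prop
    extends Frame n m A s where
  done : s.reg 3 = u
  unassigned : ld n (s.arr 12) 0 + u = n
  loads : ∀ e ≠ 0, s.arr 13 e = ld n (s.arr 12) e
  marks : ∀ x, s.arr 14 x ≤ s.reg 4
  good : ∃ y, Good n m (A 10) (A 11) (s.arr 12) y

/-- The state while jobs are being shifted: machine `reg 14` is owed a job. -/
structure Shifting (n m : ℕ) (A : ℕ → ℕ → ℕ) (σ l y mk par : ℕ → ℕ) (u cnt base t : ℕ) (s : Mem) :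
    Prop extends Frame n m A s where
  done : s.reg 3 = u
  count : s.reg 4 = cnt
  loads : s.arr 13 = Function.update l t (l t + 1)
  marks : s.arr 14 = mk
  parents : s.arr 15 = par
  state : Augmenting n m (A 10) (A 11) σ y mk par base (ld n σ t + 1) t (s.arr 12) (s.reg 14)

theorem within_augment (hl : ∀ e ≠ 0, l e = ld n σ e) (hI : Instance n m (A 10) (A 11))
    (h : Selecting n m A σ l u base m s) (hun : ld n σ 0 + u = n) (hpos : 0 < ld n σ 0)
    {y : ℕ → ℕ} (hg : Good n m (A 10) (A 11) σ y) :
    Within (.seq augment (.inc 3)) (m * 10 + 10) s (Phase n m A (u + 1)) := by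
  obtain ⟨ht0, ht, hmin⟩ := h.spec hl hI hpos
  obtain ⟨⟨⟨h0, h1, h2, hf⟩, hu, hb, ha, hld, hS⟩, hcl, -, -, -⟩ := h
  obtain ⟨t, hte⟩ : ∃ t, s.reg 14 = t := ⟨_, rfl⟩
  obtain ⟨mk, hmk⟩ : ∃ mk, s.arr 14 = mk := ⟨_, rfl⟩
  obtain ⟨par, hpar⟩ : ∃ par, s.arr 15 = par := ⟨_, rfl⟩
  obtain ⟨cnt, hcnt⟩ : ∃ cnt, s.reg 4 = cnt := ⟨_, rfl⟩
  rw [hmk, hpar, hcnt] at hS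
  rw [hmk] at hcl
  rw [hte] at ht0
  rw [hte, hmk] at ht hmin
  refine (Within.seq (B₁ := m * 9 + 7) (B₂ := 1)
    (R := fun s => Shifting n m A σ l y mk par u cnt base t s ∧ s.reg 14 = 0)
    ((Within.seq (B₁ := 5) (R := Shifting n m A σ l y mk par u cnt base t) (Within.of_exec rfl ?_)
      fun s h => (Within.loop (B := 7) _ (fun s => mk (s.reg 14) - base) ?_ m s h ?_).mono
        le_rfl ?_).mono (by omega) fun s h => h) ?_).mono (by omega) fun s h => h
  · refine ⟨⟨?_, ?_, ?_, ?_⟩, ?_, ?_, ?_, ?_, ?_, ?_⟩ <;>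
      simp [exec, hte, hld, ha] <;> try assumption
    · intro a ha
      simpa [show a ≠ 13 by omega] using hf a ha
    · exact Augmenting.start hg hI hcl hS.forest ht (hS.le t) ht0 rfl
  · rintro s ⟨⟨h0, h1, h2, hf⟩, hu, hcnt, hld, hmk, hpar, hA⟩ hc
    have hc' : s.reg 14 ≠ 0 := by
      simp only [Test.holds, h2, decide_eq_true_eq] at hc
      omega
    obtain ⟨hA', hlt⟩ := hA.next hI hc'
    refine Within.of_exec rfl ⟨⟨⟨?_, ?_, ?_, ?_⟩, ?_, ?_, ?_, ?_, ?_, ?_⟩, ?_⟩ <;>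
      simp [augmentBody, exec, hpar] <;> try assumption
    · intro a ha
      simpa [show a ≠ 12 by omega] using hf a ha
    · have := hA'.marked
      omega
  · have h3 := hS.sub_le
    have h4 := hS.le (s.reg 14)
    omega
  · rintro s ⟨h, hc⟩
    refine ⟨h, ?_⟩
    simp only [Test.holds, h.zero, decide_eq_false_iff_not] at hc
    omega
  · rintro s ⟨⟨⟨h0, h1, h2, hf⟩, hu, hcnt, hld, hmk, hpar, hA⟩, hz⟩
    rw [hz] at hA
    have hload := hA.load
    refine Within.of_exec rfl ⟨⟨?_, ?_, ?_, ?_⟩, ?_, ?_, ?_, ?_, ?_⟩ <;> simp [exec] <;>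
      try assumption
    · have := hload 0
      rw [if_pos rfl, if_neg (Ne.symm ht0)] at this
      omega
    · intro e he
      have := hload e
      rw [if_neg he] at this
      rw [hld, Function.update_apply]
      split_ifs at this ⊢ with het
      · subst het
        rw [hl e he]
        omega
      · rw [hl e he]
        omega
    · rw [hmk, hcnt]
      exact hS.le
    · exact ⟨_, hA.finish hg ht rfl hmin⟩

theorem within_phase (hI : Instance n m (A 10) (A 11)) (hu : u < n) (h : Phase n m A u s) :
    Within phase ((n + 1) * (m * 32 + 8) + m * 30 + 40) s (Phase n m A (u + 1)) := by
  obtain ⟨⟨h0, h1, h2, hf⟩, h3, hun, hld, hmk, y, hg⟩ := h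
  refine (Within.seq (B₁ := 5) (R := Searching n m A (s.arr 12) (s.arr 13) u (s.reg 4 + 1))
    (Within.of_exec rfl ?_) fun s₁ hs₁ => Within.seq (within_search hld hI hs₁) fun s₂ hs₂ =>
      Within.seq (within_select hI hs₂.1 hs₂.2) fun s₃ hs₃ =>
        within_augment hld hI hs₃ hun (by omega) hg).mono (by omega) fun s h => h
  refine ⟨⟨?_, ?_, ?_, ?_⟩, ?_, ?_, ?_, ?_, ?_⟩ <;> simp [exec, h2] <;> try assumption
  · intro a ha
    simpa [show a ≠ 14 by omega] using hf a ha
  · exact Search.start hmk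

/-- The program `core`, started with the allowed pairs in arrays `10` and `11` and with cleared
arrays `12` to `15`, leaves an optimal assignment in array `12`. -/
theorem within_core (hI : Instance n m (A 10) (A 11)) (h0 : s.reg 0 = n) (h1 : s.reg 1 = m)
    (hA : s.arr = A) (hclear : ∀ a, 12 ≤ a → a ≤ 15 → A a = 0) :
    Within core (n * ((n + 1) * (m * 32 + 8) + m * 30 + 42) + 5) s fun s' =>
      s'.reg 0 = n ∧ (∀ a, a < 12 ∨ 15 < a → s'.arr a = A a) ∧
      (∀ i < n, ∃ q < m, A 10 q = i ∧ A 11 q = s'.arr 12 i) ∧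
      ∀ τ : ℕ → ℕ, (∀ i < n, ∃ q < m, A 10 q = i ∧ A 11 q = τ i) →
        cost n (s'.arr 12) ≤ cost n τ := by
  refine (Within.seq (B₁ := 3) (R := Phase n m A 0) (Within.of_exec rfl ?_) fun s h =>
    (Within.count (M := n) (Phase n m A) (fun k s h => ⟨h.done, h.jobs⟩)
      (fun k s hk h => within_phase hI hk h) h).mono le_rfl ?_).mono (le_of_eq (by ring)) fun s h => h
  · have e0 : ld n 0 0 = n := by simp [ld]
    have e1 : ∀ e ≠ 0, ld n 0 e = 0 := fun e he => by simp [ld, he.symm]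
    refine ⟨⟨?_, ?_, ?_, ?_⟩, ?_, ?_, ?_, ?_, ?_⟩ <;>
      simp [exec, hA, hclear 12, hclear 13, hclear 14] <;> try assumption
    · exact fun e he => (e1 e he).symm
    · exact ⟨0, by simp, rfl, by simp, fun e he => (e1 e he).le, by simp⟩
  · rintro s ⟨⟨h0, h1, h2, hf⟩, h3, hun, hld, hmk, y, hg⟩
    have hz : ld n (s.arr 12) 0 = 0 := by omega
    refine ⟨h0, hf, fun i hi => hg.valid i hi fun he => ?_, fun τ => hg.cost_le hI hz⟩
    have := ld_pos (σ := s.arr 12) hi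
    rw [he] at this
    omega

end SemiMatching

/-! ### The program for restricted assignment -/

namespace RestrictedAssignment

open RAM SemiMatching Finset

section

variable {J M : Type*} [Fintype J] [Fintype M] [DecidableEq M]

theorem sum_load_sq (σ : J → M) : ∑ e, load σ e ^ 2 = ∑ j, load σ (σ j) := by
  rw [← sum_fiberwise_of_maps_to (s := univ) (t := univ) (g := σ) (fun _ _ => mem_univ _)]
  refine sum_congr rfl fun e _ => ?_
  rw [sum_congr rfl (g := fun _ => load σ e) (by simp +contextual)]
  simp [load, sq]

/-- Numbering the jobs and naming the machines by numbers does not change the sum of squares. -/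
theorem sum_load_sq_eq_cost {n : ℕ} (φ : Fin n ≃ J) (σ : J → M) (σ' : ℕ → ℕ)
    (h : ∀ i i' : Fin n, σ' i = σ' i' ↔ σ (φ i) = σ (φ i')) :
    ∑ e, load σ e ^ 2 = cost n σ' := by
  rw [sum_load_sq, cost, sum_range, ← φ.sum_comp]
  refine sum_congr rfl fun i _ => ?_
  rw [load, ld, card_filter, card_filter, sum_range, ← φ.sum_comp]
  simp only [h]

theorem l2Norm_sq (σ : J → M) : l2Norm σ ^ 2 = ((∑ e, load σ e ^ 2 : ℕ) : ℝ) := by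
  rw [l2Norm, Real.sq_sqrt (by positivity)]
  push_cast
  rfl

theorem l2Norm_le_iff (σ τ : J → M) :
    l2Norm σ ≤ l2Norm τ ↔ ∑ e, load σ e ^ 2 ≤ ∑ e, load τ e ^ 2 := by
  rw [← Nat.cast_le (α := ℝ), ← l2Norm_sq, ← l2Norm_sq, sq_le_sq₀]
  all_goals exact Real.sqrt_nonneg _

end

/-- The time bound of `core` is `O(n² m)`, which is within `O(n³ m)` unless there are jobs but no
pairs. -/
theorem core_time_le {n m : ℕ} (h : n = 0 ∨ 1 ≤ m) :
    n * ((n + 1) * (m * 32 + 8) + m * 30 + 42) + 5 ≤ 152 * (n ^ 3 * m) + 5 := by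
  rcases Nat.eq_zero_or_pos n with rfl | hn
  · simp
  have hm : 1 ≤ m := h.resolve_left hn.ne'
  have h1 : (n + 1) * (m * 32 + 8) ≤ (2 * n) * (40 * m) := Nat.mul_le_mul (by omega) (by omega)
  have h2 : m ≤ n * m := Nat.le_mul_of_pos_left m hn
  have h3 : (n + 1) * (m * 32 + 8) + m * 30 + 42 ≤ 152 * (n * m) := by
    have : 2 * n * (40 * m) = 80 * (n * m) := by ring
    omega
  have h4 : n * (n * m) ≤ n ^ 3 * m := by
    have : n * (n * m) * 1 ≤ n * (n * m) * n := Nat.mul_le_mul_left _ hn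
    linarith [this, show n * (n * m) * n = n ^ 3 * m by ring]
  have h5 := Nat.mul_le_mul_left n h3
  have : n * (152 * (n * m)) = 152 * (n * (n * m)) := by ring
  omega

/-- Copy the input to arrays `10` and `11`, where the machines are numbered from `1`. -/
def readPairs : Cmd :=
  .seq (.const 7 0) <| .loop (.lt 7 1) <|
    .seq (.load 8 0 7) <| .seq (.store 10 7 8) <| .seq (.load 9 1 7) <| .seq (.inc 9) <|
    .seq (.store 11 7 9) (.inc 7)

/-- Copy the assignment to array `2`, undoing the shift of the machine numbers. -/
def writeMachines : Cmd :=
  .seq (.const 7 0) <| .loop (.lt 7 0) <|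
    .seq (.load 8 12 7) <| .seq (.dec 8) <| .seq (.store 2 7 8) (.inc 7)

/-- The state after `k` of the pairs in arrays `P`, `Q` have been copied. -/
structure Reading (n m : ℕ) (P Q : ℕ → ℕ) (k : ℕ) (s : Mem) : Prop where
  jobs : s.reg 0 = n
  pairs : s.reg 1 = m
  idx : s.reg 7 = k
  job : s.arr 0 = P
  machine : s.arr 1 = Q
  clear : ∀ a, 12 ≤ a → a ≤ 15 → s.arr a = 0
  copied : ∀ q < k, s.arr 10 q = P q ∧ s.arr 11 q = Q q + 1

theorem within_readPairs {n m : ℕ} {s : Mem} (h0 : s.reg 0 = n) (h1 : s.reg 1 = m)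
    (hc : ∀ a, 12 ≤ a → a ≤ 15 → s.arr a = 0) :
    Within readPairs (m * 13 + 3) s (Reading n m (s.arr 0) (s.arr 1) m) := by
  refine (Within.seq (B₁ := 1) (R := Reading n m (s.arr 0) (s.arr 1) 0) (Within.of_exec rfl ?_)
    fun s' h => Within.count (B := 11) (Reading n m (s.arr 0) (s.arr 1))
      (fun k s h => ⟨h.idx, h.pairs⟩) ?_ h).mono (by omega) fun s h => h
  · refine ⟨?_, ?_, ?_, ?_, ?_, ?_, ?_⟩ <;> simp [exec] <;> assumption
  · rintro k s hk ⟨h0, h1, h7, hP, hQ, hc, hcp⟩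
    refine Within.of_exec rfl ⟨?_, ?_, ?_, ?_, ?_, ?_, ?_⟩ <;>
      simp [exec, h7, hP, hQ] <;> try assumption
    · intro a ha ha'
      simpa [show a ≠ 10 by omega, show a ≠ 11 by omega] using hc a ha ha'
    · intro q hq
      rcases Nat.lt_or_eq_of_le hq with hq | rfl
      · simpa [Function.update_of_ne hq.ne] using hcp q hq
      · simp

theorem within_writeMachines {n : ℕ} {s : Mem} (h0 : s.reg 0 = n) :
    Within writeMachines (n * 9 + 3) s fun s' => ∀ i < n, s'.arr 2 i = s.arr 12 i - 1 := by
  refine (Within.seq (B₁ := 1) (R := fun s' => (s'.reg 0 = n ∧ s'.reg 7 = 0 ∧ s'.arr 12 = s.arr 12))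
    (Within.of_exec rfl ?_) fun s' h => (Within.count (r := 7) (l := 0) (B := 7) (M := n)
      (fun k s' => s'.reg 0 = n ∧ s'.reg 7 = k ∧ s'.arr 12 = s.arr 12 ∧
        ∀ i < k, s'.arr 2 i = s.arr 12 i - 1) (fun k s h => ⟨h.2.1, h.1⟩) ?_ (s := s')
        ⟨h.1, h.2.1, h.2.2, by simp⟩).mono le_rfl fun s h => h.2.2.2).mono (by omega) fun s h => h
  · simpa [exec] using h0
  · rintro k s' hk ⟨h0, h7, ha, hw⟩
    refine Within.of_exec rfl ⟨?_, ?_, ?_, ?_⟩ <;> simp [exec, h7, ha] <;> try assumption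
    intro q hq
    rcases Nat.lt_or_eq_of_le hq with hq | rfl
    · simpa [Function.update_of_ne hq.ne] using hw q hq
    · simp

/-- `ℓ₂`-optimal restricted assignment of unit jobs is solved in time `O(n³ m)`. -/
theorem exists_program : ∃ (P : RAM.Cmd) (C : ℕ), ∀ (n k m : ℕ) (allowed : Finset (Fin n × Fin k))
      (p : Fin m → Fin n × Fin k),
      Set.BijOn p Set.univ (allowed : Set (Fin n × Fin k)) →
      (∀ j, ∃ e, (j, e) ∈ allowed) →
      ∃ (s : RAM.Mem) (σ : Fin n → Fin k),
        RAM.HaltsWithin P (RestrictedAssignment.input p) (C * (n ^ 3 * m + 1)) s ∧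
        (∀ j : Fin n, s.arr 2 j = σ j) ∧
        RestrictedAssignment.IsOptimal allowed σ := by
  refine ⟨.seq readPairs (.seq core writeMachines), 174, fun n k m allowed p hp hex => ?_⟩
  have hmem : ∀ q : Fin m, p q ∈ allowed := fun q => hp.mapsTo (Set.mem_univ q)
  have hsurj : ∀ j e, (j, e) ∈ allowed → ∃ q : Fin m, p q = (j, e) := fun j e h => by
    obtain ⟨q, -, hq⟩ := hp.surjOn h
    exact ⟨q, hq⟩
  have hP : ∀ q (h : q < m), (input p).arr 0 q = (p ⟨q, h⟩).1 := fun q h => by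
    simp [input, pad, h]
  have hQ : ∀ q (h : q < m), (input p).arr 1 q = (p ⟨q, h⟩).2 := fun q h => by
    simp [input, pad, h]
  have h0m : n = 0 ∨ 1 ≤ m := by
    rcases Nat.eq_zero_or_pos n with hn | hn
    · exact .inl hn
    · obtain ⟨e, he⟩ := hex ⟨0, hn⟩
      obtain ⟨q, -⟩ := hsurj _ _ he
      exact .inr (by have := q.2; omega)
  have hm0 : m = 0 ∨ 1 ≤ n := by
    rcases Nat.eq_zero_or_pos m with hm | hm
    · exact .inl hm
    · exact .inr (by have := (p ⟨0, hm⟩).1.2; omega)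
  have hrun : Within (.seq readPairs (.seq core writeMachines)) (174 * (n ^ 3 * m + 1)) (input p)
      fun s => ∃ σ : Fin n → Fin k, (∀ j : Fin n, s.arr 2 j = σ j) ∧ IsOptimal allowed σ := by
    refine (Within.seq (within_readPairs (n := n) (m := m) (by simp [input]) (by simp [input])
      fun a ha ha' => ?_) fun s hs => Within.seq (within_core (m := m) (A := s.arr) ?_ hs.jobs
        hs.pairs rfl hs.clear) fun s' hs' => (within_writeMachines hs'.1).mono le_rfl ?_).mono
          ?_ fun s h => h
    · funext i
      simp [input, show a ≠ 0 by omega, show a ≠ 1 by omega]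
    · refine ⟨fun q hq => ?_, fun q hq => ?_, fun i hi => ?_⟩
      · rw [(hs.copied q hq).1, hP q hq]
        exact Fin.is_lt _
      · rw [(hs.copied q hq).2]
        omega
      · obtain ⟨e, he⟩ := hex ⟨i, hi⟩
        obtain ⟨q, hq⟩ := hsurj _ _ he
        exact ⟨q, q.2, by rw [(hs.copied q q.2).1, hP q q.2, Fin.eta, hq]⟩
    · intro s'' hs''
      obtain ⟨-, -, hval, hopt⟩ := hs'
      have hchoice : ∀ i : Fin n, ∃ e : Fin k, (i, e) ∈ allowed ∧ s'.arr 12 i = e + 1 := by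
        intro i
        obtain ⟨q, hq, h1, h2⟩ := hval i i.2
        rw [(hs.copied q hq).1, hP q hq] at h1
        rw [(hs.copied q hq).2, hQ q hq] at h2
        refine ⟨(p ⟨q, hq⟩).2, ?_, h2.symm⟩
        rw [← Fin.ext h1]
        exact hmem ⟨q, hq⟩
      choose σ hσ hσ' using hchoice
      refine ⟨σ, fun j => by rw [hs'' j j.2, hσ' j, Nat.add_sub_cancel], hσ, fun τ hτ => ?_⟩
      let τ' : ℕ → ℕ := fun i => if h : i < n then τ ⟨i, h⟩ + 1 else 0
      have hτ' : ∀ i : Fin n, τ' i = τ i + 1 := fun i => by simp [τ']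
      rw [l2Norm_le_iff, sum_load_sq_eq_cost (Equiv.refl _) σ (s'.arr 12),
        sum_load_sq_eq_cost (Equiv.refl _) τ τ']
      · refine hopt τ' fun i hi => ?_
        obtain ⟨q, hq⟩ := hsurj _ _ (hτ ⟨i, hi⟩)
        refine ⟨q, q.2, ?_, ?_⟩
        · rw [(hs.copied q q.2).1, hP q q.2, Fin.eta, hq]
        · rw [(hs.copied q q.2).2, hQ q q.2, Fin.eta, hq]
          exact (hτ' ⟨i, hi⟩).symm
      · intro i i'
        simp [hτ', Fin.ext_iff]
      · intro i i'
        simp [hσ', Fin.ext_iff]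
    · have h1 := core_time_le h0m
      have h2 : m ≤ n ^ 3 * m := by
        rcases hm0 with rfl | hn
        · simp
        · exact Nat.le_mul_of_pos_left m (by positivity)
      have h3 : n ≤ n ^ 3 * m := by
        rcases h0m with rfl | hm
        · simp
        · calc n ≤ n ^ 3 := Nat.le_self_pow (by norm_num) n
            _ ≤ n ^ 3 * m := Nat.le_mul_of_pos_right _ hm
      omega
  obtain ⟨s, hs, σ, h1, h2⟩ := hrun.haltsWithin
  exact ⟨s, σ, hs, h1, h2⟩

end RestrictedAssignment

/-! ### The reduction to restricted assignment -/

namespace TriangleAssignment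

open Finset

variable {N : ℕ} {G : SimpleGraph (Fin N)} [DecidableRel G.Adj]

theorem edgesOf_eq {T : Finset (Fin N)} {a b c : Fin N} (hab : G.Adj a b) (hac : G.Adj a c)
    (hbc : G.Adj b c) (hT : T = {a, b, c}) : edgesOf G T = {s(a, b), s(b, c), s(c, a)} := by
  subst hT
  ext e
  induction e with
  | _ u v =>
    simp only [edgesOf, mem_filter, SimpleGraph.mem_edgeFinset, SimpleGraph.mem_edgeSet,
      Sym2.mem_iff, mem_insert, mem_singleton, Sym2.eq_iff]
    constructor
    · rintro ⟨h, hv⟩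
      have hne := h.ne
      rcases hv u (.inl rfl) with rfl | rfl | rfl <;> rcases hv v (.inr rfl) with rfl | rfl | rfl <;>
        simp_all
    · rintro ((⟨rfl, rfl⟩ | ⟨rfl, rfl⟩) | (⟨rfl, rfl⟩ | ⟨rfl, rfl⟩) | (⟨rfl, rfl⟩ | ⟨rfl, rfl⟩)) <;>
        simp_all [G.adj_comm]

theorem card_edgesOf {T : Finset (Fin N)} (hT : T ∈ triangles G) : #(edgesOf G T) = 3 := by
  rw [SimpleGraph.mem_cliqueFinset_iff, SimpleGraph.is3Clique_iff] at hT
  obtain ⟨a, b, c, hab, hac, hbc, h⟩ := hT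
  rw [edgesOf_eq hab hac hbc h, card_eq_three]
  refine ⟨_, _, _, ?_, ?_, ?_, rfl⟩ <;> have := hab.ne <;> have := hac.ne <;> have := hbc.ne <;>
    simp <;> tauto

variable (G) in
theorem card_allowed : #(allowed G) = 3 * #(triangles G) := by
  have h : ∀ T : triangles G, #{e : G.edgeFinset | (e : Sym2 (Fin N)) ∈ edgesOf G T} = 3 := by
    intro T
    rw [← card_edgesOf T.2, ← card_map (Function.Embedding.subtype _)]
    congr 1
    ext e
    simp only [mem_map, mem_filter, mem_univ, true_and, Function.Embedding.coe_subtype,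
      Subtype.exists, exists_and_left, exists_prop, exists_eq_right_right]
    exact ⟨fun h => h.1, fun h => ⟨h, (mem_filter.1 h).1⟩⟩
  have : #(allowed G) = ∑ T : triangles G,
      #{e : G.edgeFinset | (e : Sym2 (Fin N)) ∈ edgesOf G T} := by
    simp only [allowed, card_filter, ← univ_product_univ, sum_product]
  rw [this, sum_congr rfl fun T _ => h T]
  simp [mul_comm]

theorem mem_allowed {T : triangles G} {e : G.edgeFinset} :
    (T, e) ∈ allowed G ↔ (e : Sym2 (Fin N)) ∈ edgesOf G T := by
  simp [allowed]

theorem feasible_iff (x : Finset (Fin N) → Sym2 (Fin N) → ℕ) :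
    Feasible G x ↔ ∃ σ, RestrictedAssignment.IsAssignment (allowed G) σ ∧ Encodes G x σ := by
  constructor
  · rintro ⟨h1, h2⟩
    have hex : ∀ T : triangles G, ∃ e : G.edgeFinset, (e : Sym2 (Fin N)) ∈ edgesOf G T ∧
        x T e = 1 := by
      intro T
      obtain ⟨e, he, hx⟩ := exists_ne_zero_of_sum_ne_zero ((h1 T T.2).trans_ne one_ne_zero)
      exact ⟨⟨e, (mem_filter.1 he).1⟩, he, (h2 T T.2 e he).resolve_left hx⟩
    choose σ hσ hx using hex
    refine ⟨σ, fun T => mem_allowed.2 (hσ T), fun T e he => ?_⟩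
    split_ifs with heq
    · rw [← heq, hx T]
    · have hsum := h1 T T.2
      rw [← add_sum_erase _ _ (hσ T), hx T] at hsum
      exact sum_eq_zero_iff.1 (by omega) e (mem_erase.2 ⟨Ne.symm heq, he⟩)
  · rintro ⟨σ, hσ, hx⟩
    refine ⟨fun T hT => ?_, fun T hT e he => ?_⟩
    · rw [sum_congr rfl fun e he => hx ⟨T, hT⟩ e he, sum_ite_eq,
        if_pos (mem_allowed.1 (hσ ⟨T, hT⟩))]
    · rw [hx ⟨T, hT⟩ e he]
      split_ifs <;> simp

theorem objective_eq {x : Finset (Fin N) → Sym2 (Fin N) → ℕ} {σ : triangles G → G.edgeFinset}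
    (hσ : RestrictedAssignment.IsAssignment (allowed G) σ) (hx : Encodes G x σ) :
    objective G x = ∑ e, RestrictedAssignment.load σ e ^ 2 := by
  rw [objective, ← sum_coe_sort]
  refine sum_congr rfl fun e _ => ?_
  congr 1
  rw [RestrictedAssignment.load, card_filter, sum_filter, ← sum_coe_sort]
  refine sum_congr rfl fun T _ => ?_
  split_ifs with h1 h2 h2
  · rw [hx T e h1, if_pos (congrArg _ h2)]
  · rw [hx T e h1, if_neg fun h => h2 (Subtype.ext h)]
  · exact absurd (h2 ▸ mem_allowed.1 (hσ T)) h1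
  · rfl

/-- Every assignment is encoded by some feasible point. -/
theorem exists_encodes (σ : triangles G → G.edgeFinset) : ∃ x, Encodes G x σ :=
  ⟨fun T e => if h : T ∈ triangles G then if (σ ⟨T, h⟩ : Sym2 (Fin N)) = e then 1 else 0 else 0,
    fun T e _ => by simp⟩

theorem isOptimal_iff {x : Finset (Fin N) → Sym2 (Fin N) → ℕ} {σ : triangles G → G.edgeFinset}
    (hσ : RestrictedAssignment.IsAssignment (allowed G) σ) (hx : Encodes G x σ) :
    IsOptimal G x ↔ RestrictedAssignment.IsOptimal (allowed G) σ := by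
  constructor
  · rintro ⟨-, hopt⟩
    refine ⟨hσ, fun τ hτ => ?_⟩
    obtain ⟨y, hy⟩ := exists_encodes τ
    rw [RestrictedAssignment.l2Norm_le_iff, ← objective_eq hσ hx, ← objective_eq hτ hy]
    exact hopt y ((feasible_iff y).2 ⟨τ, hτ, hy⟩)
  · rintro ⟨-, hopt⟩
    refine ⟨(feasible_iff x).2 ⟨σ, hσ, hx⟩, fun y hy => ?_⟩
    obtain ⟨τ, hτ, hy⟩ := (feasible_iff y).1 hy
    rw [objective_eq hσ hx, objective_eq hτ hy, ← RestrictedAssignment.l2Norm_le_iff]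
    exact hopt τ hτ

end TriangleAssignment

/-! ### The program for triangles -/

namespace TriangleAssignment

open RAM SemiMatching Finset

/-- Append the pair of job `reg 3` and the edge with endpoints `reg u` and `reg v`. -/
def append (u v : ℕ) : Cmd :=
  .seq (.store 10 1 3) <| .seq (.store 16 1 u) <| .seq (.store 17 1 v) (.inc 1)

/-- List the edges of all triangles: the job in array `10`, the endpoints in arrays `16`, `17`. -/
def listEdges : Cmd :=
  .seq (.seq (.const 1 0) (.const 3 0)) <| .loop (.lt 3 0) <|
    .seq (.load 8 0 3) <| .seq (.load 9 1 3) <| .seq (.load 13 2 3) <|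
    .seq (append 8 9) <| .seq (append 9 13) <| .seq (append 13 8) (.inc 3)

/-- If registers `a`, `b` and registers `c`, `d` are equal, copy register `7` to register `9`. -/
def setIfEq (a b c d : ℕ) : Cmd := .ite (.eq a b) (.ite (.eq c d) (.copy 9 7) .skip) .skip

theorem exec_setIfEq (a b c d : ℕ) (s : Mem) : exec (setIfEq a b c d) s =
    s.setReg 9 (if s.reg a = s.reg b ∧ s.reg c = s.reg d then s.reg 7 else s.reg 9) := by
  have h : s.setReg 9 (s.reg 9) = s := by simp [Mem.setReg]
  by_cases h1 : s.reg a = s.reg b <;> by_cases h2 : s.reg c = s.reg d <;>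
    simp [setIfEq, exec, Test.holds, h1, h2, h]

/-- If the edges in positions `reg 3` and `reg 7` are equal, set register `9` to `reg 7 + 1`. -/
def compareBody : Cmd :=
  .seq (.load 12 16 7) <| .seq (.load 13 17 7) <| .seq (.inc 7) <|
  .seq (setIfEq 10 12 11 13) (setIfEq 10 13 11 12)

/-- Name each edge by the last position, counted from `1`, in which it is listed. -/
def nameEdges : Cmd :=
  .seq (.const 3 0) <| .loop (.lt 3 1) <|
    .seq (.seq (.load 10 16 3) <| .seq (.load 11 17 3) <| .seq (.const 9 0) (.const 7 0)) <|
    .seq (.loop (.lt 7 1) compareBody) <| .seq (.store 11 3 9) (.inc 3)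

/-- Write the endpoints of the edge to which each triangle is assigned to arrays `3` and `4`. -/
def writeEdges : Cmd :=
  .seq (.const 7 0) <| .loop (.lt 7 0) <|
    .seq (.load 8 12 7) <| .seq (.dec 8) <| .seq (.load 9 16 8) <| .seq (.store 3 7 9) <|
    .seq (.load 9 17 8) <| .seq (.store 4 7 9) (.inc 7)

/-- The state after the edges of the first `k` triangles have been listed: position `q` is for
triangle `q / 3`, with nodes `q % 3` and `(q + 1) % 3` of it. -/
structure Listing (n : ℕ) (A : ℕ → ℕ → ℕ) (k : ℕ) (s : Mem) : Prop where
  jobs : s.reg 0 = n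
  pairs : s.reg 1 = 3 * k
  idx : s.reg 3 = k
  nodes : ∀ a < 3, s.arr a = A a
  clear : ∀ a, 12 ≤ a → a ≤ 15 → s.arr a = 0
  job : ∀ q < 3 * k, s.arr 10 q = q / 3
  fst : ∀ q < 3 * k, s.arr 16 q = A (q % 3) (q / 3)
  snd : ∀ q < 3 * k, s.arr 17 q = A ((q + 1) % 3) (q / 3)

theorem within_listEdges {n : ℕ} {s : Mem} (h0 : s.reg 0 = n)
    (hc : ∀ a, 12 ≤ a → a ≤ 15 → s.arr a = 0) :
    Within listEdges (n * 40 + 5) s (Listing n s.arr n) := by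
  refine (Within.seq (B₁ := 3) (R := Listing n s.arr 0) (Within.of_exec rfl ?_)
    fun s' h => Within.count (B := 31) (Listing n s.arr) (fun k s h => ⟨h.idx, h.jobs⟩) ?_ h).mono
      (by omega) fun s h => h
  · refine ⟨?_, ?_, ?_, ?_, ?_, ?_, ?_, ?_⟩ <;> simp [exec] <;> assumption
  · rintro k s' hk ⟨h0, h1, h3, hA, hc, h10, h16, h17⟩
    have hA0 := hA 0 (by omega)
    have hA1 := hA 1 (by omega)
    have hA2 := hA 2 (by omega)
    have hcases : ∀ q < 3 * (k + 1), q < 3 * k ∨ q = 3 * k ∨ q = 3 * k + 1 ∨ q = 3 * k + 2 :=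
      fun q hq => by omega
    have d0 : 3 * k / 3 = k := by omega
    have d1 : (3 * k + 1) / 3 = k := by omega
    have d2 : (3 * k + 2) / 3 = k := by omega
    have m0 : 3 * k % 3 = 0 := by omega
    have m1 : (3 * k + 1) % 3 = 1 := by omega
    have m2 : (3 * k + 2) % 3 = 2 := by omega
    have m3 : (3 * k + 3) % 3 = 0 := by omega
    refine (Within.of_exec (B := _) rfl ⟨?_, ?_, ?_, ?_, ?_, ?_, ?_, ?_⟩).mono (by decide)
      fun _ h => h
    · simpa [append, exec] using h0
    · simp [append, exec, h1]
      omega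
    · simp [append, exec, h3]
    · intro a ha
      simpa [append, exec, show a ≠ 10 by omega, show a ≠ 16 by omega, show a ≠ 17 by omega]
        using hA a ha
    · intro a ha ha'
      simpa [append, exec, show a ≠ 10 by omega, show a ≠ 16 by omega, show a ≠ 17 by omega]
        using hc a ha ha'
    all_goals
      intro q hq
      rcases hcases q hq with hq | rfl | rfl | rfl
      · have e0 : q ≠ 3 * k := by omega
        have e1 : q ≠ 3 * k + 1 := by omega
        have e2 : q ≠ 3 * k + 2 := by omega
        simp [append, exec, Function.update_of_ne, *]
      all_goals
        simp [append, exec, Function.update_apply, *]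
        try omega

/-- The last position, counted from `1`, among the first `k` in which the edge number `q` of the
list is found; `0` if there is none. -/
def edgeName (U V : ℕ → ℕ) (k q : ℕ) : ℕ :=
  Nat.findGreatest (fun r => s(U (r - 1), V (r - 1)) = s(U q, V q)) k

theorem edgeName_succ (U V : ℕ → ℕ) (k q : ℕ) : edgeName U V (k + 1) q =
    if U q = U k ∧ V q = V k ∨ U q = V k ∧ V q = U k then k + 1 else edgeName U V k q := by
  simp [edgeName, Nat.findGreatest_succ, eq_comm, and_comm]

theorem edgeName_spec (U V : ℕ → ℕ) {k q : ℕ} (hq : q < k) : ∃ r < k, edgeName U V k q = r + 1 ∧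
    s(U r, V r) = s(U q, V q) := by
  have h1 : q + 1 ≤ edgeName U V k q := Nat.le_findGreatest hq rfl
  have h2 : edgeName U V k q ≤ k := Nat.findGreatest_le k
  exact ⟨edgeName U V k q - 1, by omega, by omega,
    Nat.findGreatest_spec (P := fun r => s(U (r - 1), V (r - 1)) = s(U q, V q)) (m := q + 1) hq rfl⟩

theorem edgeName_eq_iff (U V : ℕ → ℕ) {k q q' : ℕ} (hq : q < k) (hq' : q' < k) :
    edgeName U V k q = edgeName U V k q' ↔ s(U q, V q) = s(U q', V q') := by
  refine ⟨fun h => ?_, fun h => by simp only [edgeName, h]⟩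
  obtain ⟨r, -, h1, h2⟩ := edgeName_spec U V hq
  obtain ⟨r', -, h1', h2'⟩ := edgeName_spec U V hq'
  obtain rfl : r = r' := by omega
  rw [← h2, h2']

/-- The state after the edges in the first `k` positions have been named. -/
structure Naming (n m : ℕ) (A : ℕ → ℕ → ℕ) (k : ℕ) (s : Mem) : Prop where
  jobs : s.reg 0 = n
  pairs : s.reg 1 = m
  idx : s.reg 3 = k
  frame : ∀ a ≠ 11, s.arr a = A a
  name : ∀ q < k, s.arr 11 q = edgeName (A 16) (A 17) m q

theorem within_nameEdges {n m : ℕ} {s : Mem} (h0 : s.reg 0 = n) (h1 : s.reg 1 = m) :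
    Within nameEdges (m * (m * 15 + 15) + 3) s (Naming n m s.arr m) := by
  let A := s.arr
  refine (Within.seq (B₁ := 1) (R := Naming n m A 0) (Within.of_exec rfl ?_)
    fun s' h => Within.count (B := m * 15 + 13) (Naming n m A)
      (fun k s h => ⟨h.idx, h.pairs⟩) ?_ h).mono (le_of_eq (by ring)) fun s h => h
  · refine ⟨?_, ?_, ?_, ?_, ?_⟩ <;> simp [exec] <;> first | assumption | simp [A]
  · rintro q s' hq ⟨h0, h1, h3, hA, hname⟩
    refine (Within.seq (B₁ := 7) (R := fun s => Naming n m A q s ∧ s.reg 10 = A 16 q ∧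
      s.reg 11 = A 17 q ∧ s.reg 9 = 0 ∧ s.reg 7 = 0) (Within.of_exec rfl ?_) fun s h =>
      Within.seq (Within.count (r := 7) (l := 1) (B := 13) (M := m) (fun k s => Naming n m A q s ∧
        s.reg 10 = A 16 q ∧ s.reg 11 = A 17 q ∧ s.reg 7 = k ∧ s.reg 9 =
        edgeName (A 16) (A 17) k q)
        (fun k s h => ⟨h.2.2.2.1, h.1.pairs⟩) ?_ ⟨h.1, h.2.1, h.2.2.1, h.2.2.2.2, ?_⟩)
        (B₂ := 3) fun s h => Within.of_exec rfl ?_).mono (by omega) fun s h => h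
    · refine ⟨⟨?_, ?_, ?_, ?_, ?_⟩, ?_, ?_, ?_, ?_⟩ <;> simp [exec, h3, hA] <;> assumption
    · rintro k s hk ⟨⟨h0, h1, h3, hA, hname⟩, h10, h11, h7, h9⟩
      have h16 := hA 16 (by omega)
      have h17 := hA 17 (by omega)
      refine (Within.of_exec (B := _) rfl ?_).mono (by decide) fun _ h => h
      refine ⟨⟨?_, ?_, ?_, ?_, ?_⟩, ?_, ?_, ?_, ?_⟩ <;>
        simp [compareBody, exec, exec_setIfEq, h7, h9, h10, h11, h16, h17, edgeName_succ] <;>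
        try assumption
      split_ifs <;> tauto
    · rw [h.2.2.2.1, edgeName, Nat.findGreatest_zero]
    · obtain ⟨⟨h0, h1, h3, hA, hname⟩, h10, h11, h7, h9⟩ := h
      refine ⟨?_, ?_, ?_, ?_, ?_⟩ <;> simp [exec, h3] <;> try assumption
      · intro a ha
        simpa [ha] using hA a ha
      · intro r hr
        rcases Nat.lt_or_eq_of_le hr with hr | rfl
        · rw [Function.update_of_ne hr.ne, hname r hr]
        · rw [Function.update_self, h9]

theorem within_writeEdges {n : ℕ} {s : Mem} (h0 : s.reg 0 = n) :
    Within writeEdges (n * 15 + 3) s fun s' => ∀ i < n,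
      s'.arr 3 i = s.arr 16 (s.arr 12 i - 1) ∧ s'.arr 4 i = s.arr 17 (s.arr 12 i - 1) := by
  refine (Within.seq (B₁ := 1) (R := fun s' => s'.reg 0 = n ∧ s'.reg 7 = 0 ∧
      s'.arr = s.arr) (Within.of_exec rfl ?_) fun s' h =>
      (Within.count (r := 7) (l := 0) (B := 13) (M := n)
      (fun k s' => s'.reg 0 = n ∧ s'.reg 7 = k ∧ s'.arr 12 = s.arr 12 ∧ s'.arr 16 = s.arr 16 ∧
        s'.arr 17 = s.arr 17 ∧ ∀ i < k, s'.arr 3 i = s.arr 16 (s.arr 12 i - 1) ∧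
        s'.arr 4 i = s.arr 17 (s.arr 12 i - 1)) (fun k s h => ⟨h.2.1, h.1⟩) ?_ (s := s')
        ⟨h.1, h.2.1, by rw [h.2.2], by rw [h.2.2], by rw [h.2.2], by simp⟩).mono le_rfl
        fun s h => h.2.2.2.2.2).mono (by omega) fun s h => h
  · simpa [exec] using h0
  · rintro k s' hk ⟨h0, h7, h12, h16, h17, hw⟩
    refine Within.of_exec rfl ⟨?_, ?_, ?_, ?_, ?_, ?_⟩ <;> simp [exec, h7, h12, h16, h17] <;>
      try assumption
    intro q hq
    rcases Nat.lt_or_eq_of_le hq with hq | rfl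
    · simpa [Function.update_of_ne hq.ne] using hw q hq
    · simp

/-- The program for the triangle-to-edge assignment problem. -/
def assignTriangles : Cmd := .seq listEdges <| .seq nameEdges <| .seq core writeEdges

/-- The edges of the triangles, in the order in which `listEdges` lists them, when arrays `0`, `1`,
`2` of `A` hold the nodes of the triangles. -/
def listed (A : ℕ → ℕ → ℕ) (q : ℕ) : Sym2 ℕ := s(A (q % 3) (q / 3), A ((q + 1) % 3) (q / 3))

theorem within_assignTriangles {n : ℕ} {s : Mem} (h0 : s.reg 0 = n)
    (hc : ∀ a, 12 ≤ a → a ≤ 15 → s.arr a = 0) :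
    Within assignTriangles (1000 * (n ^ 4 + 1)) s fun s' => ∃ name σ : ℕ → ℕ,
      (∀ q < 3 * n, ∀ q' < 3 * n, name q = name q' ↔ listed s.arr q = listed s.arr q') ∧
      (∀ i < n, ∃ q < 3 * n, q / 3 = i ∧ name q = σ i ∧
        s(s'.arr 3 i, s'.arr 4 i) = listed s.arr q) ∧
      ∀ τ : ℕ → ℕ, (∀ i < n, ∃ q < 3 * n, q / 3 = i ∧ name q = τ i) → cost n σ ≤ cost n τ := by
  refine (Within.seq (within_listEdges h0 hc) fun s₁ h₁ =>
    Within.seq (within_nameEdges h₁.jobs h₁.pairs) fun s₂ h₂ =>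
    Within.seq (within_core (A := s₂.arr) ?_ h₂.jobs h₂.pairs rfl fun a ha ha' =>
      (h₂.frame a (by omega)).trans (h₁.clear a ha ha')) fun s₃ h₃ =>
    (within_writeEdges h₃.1).mono le_rfl ?_).mono ?_ fun s h => h
  · have h10 := h₂.frame 10 (by omega)
    refine ⟨fun q hq => ?_, fun q hq => ?_, fun i hi => ⟨3 * i, by omega, ?_⟩⟩
    · rw [h10, h₁.job q hq]
      omega
    · obtain ⟨r, -, hr, -⟩ := edgeName_spec (s₁.arr 16) (s₁.arr 17) hq
      rw [h₂.name q hq, hr]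
      omega
    · rw [h10, h₁.job _ (by omega)]
      omega
  · intro s₄ h₄
    obtain ⟨-, hframe, hval, hopt⟩ := h₃
    have h10 := h₂.frame 10 (by omega)
    have hlist : ∀ q < 3 * n, s(s₁.arr 16 q, s₁.arr 17 q) = listed s.arr q := fun q hq => by
      rw [h₁.fst q hq, h₁.snd q hq, listed]
    refine ⟨s₂.arr 11, s₃.arr 12, fun q hq q' hq' => ?_, fun i hi => ?_, fun τ hτ => ?_⟩
    · rw [h₂.name q hq, h₂.name q' hq', edgeName_eq_iff _ _ hq hq', hlist q hq, hlist q' hq']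
    · obtain ⟨q, hq, h1, h2⟩ := hval i hi
      rw [h10, h₁.job q hq] at h1
      refine ⟨q, hq, h1, h2, ?_⟩
      obtain ⟨r, hr, hn, hl⟩ := edgeName_spec (s₁.arr 16) (s₁.arr 17) hq
      rw [(h₄ i hi).1, (h₄ i hi).2, hframe 16 (by omega), hframe 17 (by omega),
        h₂.frame 16 (by omega), h₂.frame 17 (by omega), ← h2, h₂.name q hq, hn,
        Nat.add_sub_cancel, hl, hlist q hq]
    · refine hopt τ fun i hi => ?_
      obtain ⟨q, hq, h1, h2⟩ := hτ i hi
      exact ⟨q, hq, by rw [h10, h₁.job q hq, h1], h2⟩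
  · have h1 := RestrictedAssignment.core_time_le (n := n) (m := 3 * n) (by omega)
    have h2 : n ≤ n ^ 4 := Nat.le_self_pow (by norm_num) n
    have h3 : n ^ 2 ≤ n ^ 4 := by
      rcases Nat.eq_zero_or_pos n with rfl | hn
      · simp
      · exact Nat.pow_le_pow_right hn (by norm_num)
    have h4 : 3 * n * (3 * n * 15 + 15) = 135 * n ^ 2 + 45 * n := by ring
    have h5 : n ^ 3 * (3 * n) = 3 * n ^ 4 := by ring
    omega

variable {N : ℕ} {G : SimpleGraph (Fin N)} [DecidableRel G.Adj]

theorem edgesOf_image {f : Fin 3 → Fin N} (hf : univ.image f ∈ triangles G) :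
    edgesOf G (univ.image f) = univ.image fun j => s(f j, f (j + 1)) := by
  rw [SimpleGraph.mem_cliqueFinset_iff, SimpleGraph.isNClique_iff] at hf
  obtain ⟨hcl, hcard⟩ := hf
  have hinj : Function.Injective f := fun a b h =>
    card_image_iff.1 (hcard.trans (card_fin 3).symm) (by simp) (by simp) h
  have hadj : ∀ i j, i ≠ j → G.Adj (f i) (f j) := fun i j hij =>
    hcl (by simp) (by simp) (hinj.ne hij)
  rw [edgesOf_eq (hadj 0 1 (by decide)) (hadj 0 2 (by decide)) (hadj 1 2 (by decide))]
  · ext e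
    simp [Fin.exists_fin_succ, eq_comm]
  · ext v
    simp [Fin.exists_fin_succ, eq_comm]

/-- The triangle-to-edge assignment problem is solved in time quartic in the number of triangles. -/
theorem exists_program : ∃ (P : RAM.Cmd) (C : ℕ), ∀ (N : ℕ) (G : SimpleGraph (Fin N))
      [DecidableRel G.Adj] (tri : Fin (TriangleAssignment.triangles G).card → Fin 3 → Fin N),
      TriangleAssignment.Enumerates G tri →
      ∃ s x,
        RAM.HaltsWithin P (TriangleAssignment.input tri)
          (C * ((TriangleAssignment.triangles G).card ^ 4 + 1)) s ∧
        TriangleAssignment.Outputs G tri s x ∧ TriangleAssignment.IsOptimal G x := by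
  refine ⟨assignTriangles, 1000, fun N G _ tri htri => ?_⟩
  obtain ⟨s, hs, name, σ', hname, hval, hopt⟩ := (within_assignTriangles
    (n := #(triangles G)) (s := input tri)
    (by simp [input]) fun a ha _ => by
      simp only [input, dif_neg (show ¬ a < 3 by omega)]
      rfl).haltsWithin
  have hT : ∀ i, univ.image (tri i) ∈ triangles G := fun i => htri.mapsTo (Set.mem_univ i)
  let φ : Fin #(triangles G) ≃ triangles G := Equiv.ofBijective
    (fun i => ⟨univ.image (tri i), hT i⟩)
    ⟨fun i i' h => htri.injOn (Set.mem_univ i) (Set.mem_univ i') (congrArg Subtype.val h),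
      fun T => by
        obtain ⟨i, -, hi⟩ := htri.surjOn T.2
        exact ⟨i, Subtype.ext hi⟩⟩
  have hφ : ∀ i, (φ i : Finset (Fin N)) = univ.image (tri i) := fun i => rfl
  let E : Fin #(triangles G) → Fin 3 → Sym2 (Fin N) := fun i j => s(tri i j, tri i (j + 1))
  have hE : ∀ i e, e ∈ edgesOf G (φ i) ↔ ∃ j, E i j = e := fun i e => by
    rw [hφ, edgesOf_image (hT i)]
    simp [E]
  have hval_inj : Function.Injective (Sym2.map (fun v : Fin N => (v : ℕ))) :=
    Sym2.map.injective Fin.val_injective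
  have hlisted : ∀ (i : Fin #(triangles G)) (j : Fin 3),
      listed (input tri).arr (3 * i + j) = Sym2.map (fun v : Fin N => (v : ℕ)) (E i j) := by
    intro i j
    have e1 : (3 * (i : ℕ) + j) / 3 = i := by omega
    have e2 : (3 * (i : ℕ) + j) % 3 = j := by omega
    have e3 : (3 * (i : ℕ) + j + 1) % 3 = (j + 1 : Fin 3) := by
      fin_cases j <;> simp <;> omega
    simp only [listed, e1, e2, e3, input, Fin.is_lt, dif_pos, pad, Fin.eta, E, Sym2.map_mk]
  have hslot : ∀ i : Fin #(triangles G), ∀ q : ℕ, q / 3 = i → ∃ j : Fin 3, q = 3 * i + j :=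
    fun i q h => ⟨⟨q % 3, by omega⟩, by simp only; omega⟩
  have hlt : ∀ (i : Fin #(triangles G)) (j : Fin 3), 3 * (i : ℕ) + j < 3 * #(triangles G) :=
    fun i j => by omega
  have hchoice : ∀ i : Fin #(triangles G), ∃ j : Fin 3, name (3 * i + j) = σ' i ∧
      s(s.arr 3 i, s.arr 4 i) = Sym2.map (fun v : Fin N => (v : ℕ)) (E i j) := by
    intro i
    obtain ⟨q, -, h1, h2, h3⟩ := hval i i.2
    obtain ⟨j, rfl⟩ := hslot i q h1
    exact ⟨j, h2, h3.trans (hlisted i j)⟩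
  choose j hj hout using hchoice
  have hedge : ∀ i j, E i j ∈ G.edgeFinset := fun i j =>
    (mem_filter.1 ((hE i _).2 ⟨j, rfl⟩)).1
  let σ : triangles G → G.edgeFinset := fun T => ⟨E (φ.symm T) (j (φ.symm T)), hedge _ _⟩
  have hσφ : ∀ i, (σ (φ i) : Sym2 (Fin N)) = E i (j i) := fun i => by simp [σ]
  have hσ : RestrictedAssignment.IsAssignment (allowed G) σ := fun T => by
    obtain ⟨i, rfl⟩ := φ.surjective T
    exact mem_allowed.2 ((hE i _).2 ⟨j i, (hσφ i).symm⟩)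
  obtain ⟨x, hx⟩ := exists_encodes σ
  refine ⟨s, x, hs, fun i e he => ?_, (isOptimal_iff hσ hx).2 ⟨hσ, fun τ hτ => ?_⟩⟩
  · rw [hout i]
    refine (hx (φ i) e he).trans ?_
    simp only [hσφ, hval_inj.eq_iff, eq_comm]
  · have hchoice' : ∀ i, ∃ j, E i j = τ (φ i) := fun i => (hE i _).1 (mem_allowed.1 (hτ (φ i)))
    choose j' hj' using hchoice'
    let τ' : ℕ → ℕ := fun i =>
      if h : i < #(triangles G) then name (3 * i + j' ⟨i, h⟩) else 0
    have hτ' : ∀ i : Fin #(triangles G), τ' i = name (3 * i + j' i) := fun i => by simp [τ']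
    rw [RestrictedAssignment.l2Norm_le_iff,
      RestrictedAssignment.sum_load_sq_eq_cost φ σ σ' fun i i' => ?_,
      RestrictedAssignment.sum_load_sq_eq_cost φ τ τ' fun i i' => ?_]
    · exact hopt τ' fun i hi => ⟨3 * i + j' ⟨i, hi⟩, hlt ⟨i, hi⟩ _, by omega, (hτ' ⟨i, hi⟩).symm⟩
    · rw [hτ', hτ', hname _ (hlt _ _) _ (hlt _ _), hlisted, hlisted, hval_inj.eq_iff, hj', hj',
        Subtype.ext_iff]
    · rw [← hj, ← hj, hname _ (hlt _ _) _ (hlt _ _), hlisted, hlisted, hval_inj.eq_iff, ← hσφ,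
        ← hσφ, Subtype.ext_iff]

end TriangleAssignment

theorem mainTheorem5 :
    -- the triangle-to-edge assignment problem is solved optimally in `O(|Δ|⁴)` time
    (∃ (P : RAM.Cmd) (C : ℕ), ∀ (N : ℕ) (G : SimpleGraph (Fin N)) [DecidableRel G.Adj]
      (tri : Fin (TriangleAssignment.triangles G).card → Fin 3 → Fin N),
      TriangleAssignment.Enumerates G tri →
      ∃ s x,
        RAM.HaltsWithin P (TriangleAssignment.input tri)
          (C * ((TriangleAssignment.triangles G).card ^ 4 + 1)) s ∧
        TriangleAssignment.Outputs G tri s x ∧ TriangleAssignment.IsOptimal G x) ∧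
    -- it reduces to `ℓ₂`-optimal restricted assignment of `|Δ|` unit jobs with `3|Δ|` allowed pairs
    (∀ (N : ℕ) (G : SimpleGraph (Fin N)) [DecidableRel G.Adj],
      (TriangleAssignment.allowed G).card = 3 * (TriangleAssignment.triangles G).card ∧
      (∀ x, TriangleAssignment.Feasible G x ↔
        ∃ σ, RestrictedAssignment.IsAssignment (TriangleAssignment.allowed G) σ ∧
          TriangleAssignment.Encodes G x σ) ∧
      (∀ x σ, RestrictedAssignment.IsAssignment (TriangleAssignment.allowed G) σ →
        TriangleAssignment.Encodes G x σ →
        (TriangleAssignment.objective G x : ℝ) = RestrictedAssignment.l2Norm σ ^ 2 ∧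
        (TriangleAssignment.IsOptimal G x ↔
          RestrictedAssignment.IsOptimal (TriangleAssignment.allowed G) σ))) ∧
    -- `ℓ₂`-optimal restricted assignment of `n` unit jobs with `m` allowed job-machine pairs is
    -- solved in `O(n³m)` time
    (∃ (P : RAM.Cmd) (C : ℕ), ∀ (n k m : ℕ) (allowed : Finset (Fin n × Fin k))
      (p : Fin m → Fin n × Fin k),
      Set.BijOn p Set.univ (allowed : Set (Fin n × Fin k)) →
      (∀ j, ∃ e, (j, e) ∈ allowed) →
      ∃ (s : RAM.Mem) (σ : Fin n → Fin k),
        RAM.HaltsWithin P (RestrictedAssignment.input p) (C * (n ^ 3 * m + 1)) s ∧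
        (∀ j : Fin n, s.arr 2 j = σ j) ∧
        RestrictedAssignment.IsOptimal allowed σ) := by
  exact ⟨TriangleAssignment.exists_program, fun N G _ => ⟨TriangleAssignment.card_allowed G,
    TriangleAssignment.feasible_iff, fun x σ hσ hx => ⟨by
      rw [TriangleAssignment.objective_eq hσ hx, RestrictedAssignment.l2Norm_sq],
      TriangleAssignment.isOptimal_iff hσ hx⟩⟩, RestrictedAssignment.exists_program⟩
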